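/- **Setting.** Let $d\ge 1$, let $p_X$ be a probability measure on $\mathbb R^d$ with support $\mathcal X\subset B(0,R)$ (closed ball), $R>0$, and let $0<\sigma_T<\sigma_0<\infty$. For $\sigma>0$ let $p_\sigma=p_X*\mathcal N(0,\sigma^2 I)$, with density also denoted $p_\sigma$. Let $\mathsf k=1+\log N$, where $N$ is the least number of balls of radius $r_0=\sigma_T^2/(\sigma_0\sqrt d)$ covering $\mathcal X$. For $\omega>0$ let $q_\omega$ be the joint law of $(X,Y)$ with $X\sim p_X$, $Y\mid X\sim\mathcal N(X,\omega^2I)$, so that $q_\omega(dx\mid y)\propto e^{-\|x-y\|^2/(2\omega^2)}\,p_X(dx)$, and put $$W_\omega(y)=\mathrm{Cov}_{q_\omega}(X,\|X-Y\|^2\mid Y=y)\in\mathbb R^d .$$ For a prior probability measure $\Theta$ on $[\sigma_T,\sigma_0]$ let $\mu(d\sigma\mid y)\propto p_\sigma(y)\,\Theta(d\sigma)$ be the posterior of the noise level, $s_\sigma(y)=\sigma^2\nabla\log p_\sigma(y)$, and $s^\star(y)=\int s_\sigma(y)\,\mu(d\sigma\mid y)$. Fix $\sigma_t\in[\sigma_T,\sigma_0]$,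 let $X_t\sim p_{\sigma_t}$, and put $$\mathcal E=\mathbb E\int\Bigl|\int_\sigma^{\sigma_t}\|W_\omega(X_t)\|\,\omega^{-3}\,d\omega\Bigr|^2\mu(d\sigma\mid X_t),\qquad \mathcal M=\mathbb E\int\Bigl(\bigl|1-\tfrac{\sigma_t^2}{\sigma^2}\bigr|^2+\bigl|\log\tfrac{\sigma_t}{\sigma}\bigr|^2\Bigr)\mu(d\sigma\mid X_t).$$ **Proposition.** There is a universal constant $C>0$ such that, in every such setting, the following hold. 1. For every $\delta\in(0,1)$, with $\mathsf k_\delta=\mathsf k+\log(1/\delta)$, with probability at least $1-\delta$, simultaneously for all $\omega\ge\sigma_T$, $$\|W_\omega(X_t)\|\le C\,(\sigma_t^2+\omega^2)\,(R+\sqrt{\mathsf k_\delta})\,\mathsf k_\delta .$$ 2. For every prior $\Theta$ on $[\sigma_T,\sigma_0]$, the noise-mismatch score error satisfies $\mathbb E\|s_{\sigma_t}(X_t)-s^\star(X_t)\|^2\le\mathcal E$, and, up to logarithmic factors, $\mathcal E$ is at most $(R^2+\mathsf k)\,\mathsf k^2\,\mathcal M$; precisely (with right-hand side $0$ if $\mathcal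 M=0$), $$\mathcal E\le C\,(R^2+\mathsf k)\,\mathsf k^2\,\bigl(1+\log(\sigma_0/\sigma_T)+|\log\mathcal M|\bigr)^3\,\mathcal M .$$ 3. If $\Theta$ is the power law prior with density proportional to $\sigma^{\alpha-3}$ on $[\sigma_T,\sigma_0]$, $\alpha\in\mathbb R$, the logarithmic factor depends on the parameters only: $$\mathcal E\le C\,(R^2+\mathsf k)\,\mathsf k^2\,\bigl(1+\log d+\log(\sigma_0/\sigma_T)+\log(1+|\alpha|)\bigr)^3\,\mathcal M .$$ -/

import Mathlib

open MeasureTheory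

namespace BlindDenoising

noncomputable section

/-- Euclidean space `ℝ^d`. -/
abbrev E (d : ℕ) : Type := EuclideanSpace ℝ (Fin d)

/-- The law `p_σ = p_X * N(0, σ² I)` of `X + σ Z`, with `X ∼ p_X` and `Z ∼ N(0, I)` independent. -/
def noisyLaw {d : ℕ} (pX : Measure (E d)) (σ : ℝ) : Measure (E d) :=
  pX.conv ((ProbabilityTheory.stdGaussian (E d)).map (fun z => σ • z))

/-- The Lebesgue density of `p_σ`,
`p_σ(y) = (2πσ²)^(-d/2) 𝔼_{X ∼ p_X} exp(-‖X - y‖² / (2σ²))`. -/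
def noisyDensity {d : ℕ} (pX : Measure (E d)) (σ : ℝ) (y : E d) : ℝ :=
  ((2 * Real.pi * σ ^ 2) ^ ((d : ℝ) / 2))⁻¹ * ∫ x, Real.exp (-‖x - y‖ ^ 2 / (2 * σ ^ 2)) ∂pX

/-- The scaled score function `s_σ(y) = σ² ∇ log p_σ(y)`. -/
def score {d : ℕ} (pX : Measure (E d)) (σ : ℝ) (y : E d) : E d :=
  σ ^ 2 • gradient (fun z => Real.log (noisyDensity pX σ z)) y

/-- The conditional law of `X` given `Y = y` under `q_ω` (that is, `X ∼ p_X`, `Y ∼ N(X, ω² I)`):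
the probability measure proportional to `exp(-‖x - y‖² / (2ω²)) p_X(dx)`. -/
def posterior {d : ℕ} (pX : Measure (E d)) (ω : ℝ) (y : E d) : Measure (E d) :=
  pX.tilted (fun x => -‖x - y‖ ^ 2 / (2 * ω ^ 2))

/-- The conditional cross-covariance `W_ω(y) = Cov_{q_ω}(X, ‖X - Y‖² | Y = y)`, a vector. -/
def crossCov {d : ℕ} (pX : Measure (E d)) (ω : ℝ) (y : E d) : E d :=
  ∫ x, (‖x - y‖ ^ 2 - ∫ x', ‖x' - y‖ ^ 2 ∂(posterior pX ω y)) •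
    (x - ∫ x', x' ∂(posterior pX ω y)) ∂(posterior pX ω y)

/-- The intrinsic dimension `1 + log N(r)` of `p_X` at scale `r`, where `N(r)` is the least number
of balls of radius `r` that cover the support of `p_X`. -/
def intrinsicDimAt {d : ℕ} (pX : Measure (E d)) (r : ℝ) : ℝ :=
  1 + Real.log ((Metric.externalCoveringNumber r.toNNReal pX.support).toNat : ℝ)

/-- The intrinsic dimension at the scale `r₀ = σ_T² / (σ_0 √d)`. -/
def intrinsicDim {d : ℕ} (pX : Measure (E d)) (σT σ0 : ℝ) : ℝ :=
  intrinsicDimAt pX (σT ^ 2 / (σ0 * Real.sqrt d))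

/-- A finite nonzero measure divided by its total mass. -/
def normalize {α : Type*} [MeasurableSpace α] (m : Measure α) : Measure α :=
  (m Set.univ)⁻¹ • m

/-- The posterior law `μ(· | y)` of the noise level under the prior `Θ`:
`μ(dσ | y) ∝ p_σ(y) Θ(dσ)`. -/
def noisePosterior {d : ℕ} (pX : Measure (E d)) (Θ : Measure ℝ) (y : E d) : Measure ℝ :=
  normalize (Θ.withDensity (fun σ => ENNReal.ofReal (noisyDensity pX σ y)))

/-- The optimal blind score `s⋆(y) = ∫ σ² ∇ log p_σ(y) μ(dσ | y)`. -/
def blindScore {d : ℕ} (pX : Measure (E d)) (Θ : Measure ℝ) (y : E d) : E d :=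
  ∫ σ, score pX σ y ∂(noisePosterior pX Θ y)

/-- The power law prior with density proportional to `σ^(α - 3)` on `[σ_T, σ_0]`. -/
def powerPrior (σT σ0 α : ℝ) : Measure ℝ :=
  normalize ((volume.restrict (Set.Icc σT σ0)).withDensity
    (fun σ => ENNReal.ofReal (σ ^ (α - 3))))

/-- The noise-mismatch score error `𝔼 ‖s_τ(X_t) - s⋆(X_t)‖²`, where `X_t ∼ p_τ`. -/
def mismatchError {d : ℕ} (pX : Measure (E d)) (Θ : Measure ℝ) (τ : ℝ) : ENNReal :=
  ∫⁻ y, ENNReal.ofReal (‖score pX τ y - blindScore pX Θ y‖ ^ 2) ∂(noisyLaw pX τ)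

/-- `𝔼 ∫ |∫_σ^τ ‖W_ω(X_t)‖ ω⁻³ dω|² μ(dσ | X_t)`, where `X_t ∼ p_τ`. -/
def crossCovError {d : ℕ} (pX : Measure (E d)) (Θ : Measure ℝ) (τ : ℝ) : ENNReal :=
  ∫⁻ y, ∫⁻ σ, ENNReal.ofReal (|∫ ω in σ..τ, ‖crossCov pX ω y‖ * (ω ^ 3)⁻¹| ^ 2)
    ∂(noisePosterior pX Θ y) ∂(noisyLaw pX τ)

/-- `𝔼 ∫ (|1 - τ²/σ²|² + |log (τ/σ)|²) μ(dσ | X_t)`, where `X_t ∼ p_τ`. -/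
def noiseMoment {d : ℕ} (pX : Measure (E d)) (Θ : Measure ℝ) (τ : ℝ) : ENNReal :=
  ∫⁻ y, ∫⁻ σ, ENNReal.ofReal (|1 - τ ^ 2 / σ ^ 2| ^ 2 + |Real.log (τ / σ)| ^ 2)
    ∂(noisePosterior pX Θ y) ∂(noisyLaw pX τ)

end

end BlindDenoising

/-!
The fluctuation of the squared distance `f x = ‖x - y‖²` under the posterior `q_ω(· | y)`, a Gibbs
measure with energy `f / (2 ω²)`, controls everything: since the support has diameter at most `2 R`,
the cross-covariance `W_ω(y)` is at most `4 R` times the mean excess of `f` over any lower bound `c`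
of `f` on the support (`norm_crossCov_le`). By the Gibbs variational principle
(`integral_tilted_neg_le`) this mean excess is at most `2 ω² log (1 / p_X(B)) + b`, if `f ≤ c + b`
on a ball `B` (`posterior_norm_sq_le`). Write `y = x + τ z`. With high probability the signal `x`
lies in a ball of the optimal cover whose mass is not much smaller than `1 / N`, and the Gaussian
vector `z` has norm of order `√d` and no large correlation with any of the `N²` directions between
centres. On this event (`goodSet`, `noisyLaw_compl_goodSet_le`) there are such `c` and `b` with `b`
of order `τ² κ`, because `‖x' - x‖² - 2 τ ⟪x' - x, z⟫` is bounded below by completing the square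
(`norm_sq_bounds_of_mem_goodSet`). The event does not depend on `ω`, so the bound of order
`R (τ² + ω²) κ` holds for all `ω` at once (`exists_good_events`).

The inequality between the score error and the integrated cross-covariance is Tweedie's formula
(`score_eq`), the identity `d/dω 𝔼[X | y] = W_ω(y) / ω³` (`hasDerivAt_posteriorMean`) and Jensen's
inequality. Integration of the pointwise bound over `ω` reproduces, up to a constant factor, the
integrand of the noise moment `M`. On the complements of the good events this integrand is replaced
by its supremum `m`, which leaves an error of order `m exp (-2 (κ - k))`, where the confidence level
`κ` is free (`crossCovError_le_of_level`). It is absorbed into `M` once `κ - k` is of order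
`log (m / M)`. For a power law prior `m / M` is at most polynomial in the parameters: the logarithm
of the posterior density of the noise level is Lipschitz with a polynomial constant on a good event,
hence the posterior cannot concentrate near the true noise level (`le_noiseMoment_powerPrior`).
-/

namespace BlindDenoising

open ProbabilityTheory Real

/-! ### Gaussian tails -/

lemma integral_exp_sq_div_four_gaussianReal :
    ∫ x, exp (x ^ 2 / 4) ∂(gaussianReal 0 1) = √2 := by
  rw [integral_gaussianReal_eq_integral_smul one_ne_zero]
  have h : ∀ x : ℝ, gaussianPDFReal 0 1 x • exp (x ^ 2 / 4) =
      (√(2 * π))⁻¹ * exp (-(1 / 4) * x ^ 2) := by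
    intro x
    rw [gaussianPDFReal, smul_eq_mul, mul_assoc, ← exp_add]
    congr 2
    · simp
    · simp only [NNReal.coe_one]; ring
  simp_rw [h]
  rw [integral_const_mul, integral_gaussian, ← sqrt_inv, ← sqrt_mul (by positivity)]
  congr 1
  have := pi_pos.ne'
  field_simp
  norm_num

lemma integral_exp_norm_sq_div_four_stdGaussian (d : ℕ) :
    ∫ z, exp (‖z‖ ^ 2 / 4) ∂(stdGaussian (E d)) = √2 ^ d := by
  rw [← map_pi_eq_stdGaussian, integral_map (by fun_prop) (by fun_prop)]
  simp_rw [EuclideanSpace.real_norm_sq_eq, Finset.sum_div, exp_sum]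
  rw [integral_fintype_prod_eq_prod (fun _ x => exp (x ^ 2 / 4))]
  simp [integral_exp_sq_div_four_gaussianReal]

/-- Markov's inequality for `exp (‖z‖² / 4)`, whose mean is `√2 ^ d ≤ exp d`. -/
lemma stdGaussian_norm_tail (d : ℕ) (κ : ℝ) :
    stdGaussian (E d) {z | 4 * (d + 2 * κ) ≤ ‖z‖ ^ 2} ≤ ENNReal.ofReal (exp (-2 * κ)) := by
  have hI := integral_exp_norm_sq_div_four_stdGaussian d
  have hint : Integrable (fun z => exp (‖z‖ ^ 2 / 4)) (stdGaussian (E d)) := by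
    by_contra h
    rw [integral_undef h] at hI
    have : 0 < √2 ^ d := by positivity
    exact this.ne hI
  have hm := mul_meas_ge_le_integral_of_nonneg (μ := stdGaussian (E d))
    (Filter.Eventually.of_forall fun z => (exp_pos (‖z‖ ^ 2 / 4)).le) hint (exp (d + 2 * κ))
  rw [hI] at hm
  have hset : {z : E d | exp (d + 2 * κ) ≤ exp (‖z‖ ^ 2 / 4)} =
      {z : E d | 4 * (d + 2 * κ) ≤ ‖z‖ ^ 2} := by
    ext z
    simp only [Set.mem_ofPred_eq, exp_le_exp]
    constructor <;> intro h <;> linarith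
  rw [hset] at hm
  have hsq : √2 ^ d ≤ exp d := by
    rw [← exp_one_pow]
    gcongr
    calc √2 ≤ 2 := by rw [sqrt_le_left (by norm_num)]; norm_num
      _ ≤ exp 1 := by have := add_one_le_exp (1 : ℝ); linarith
  rw [ENNReal.le_ofReal_iff_toReal_le (measure_ne_top _ _) (exp_pos _).le]
  change (stdGaussian (E d)).real _ ≤ _
  have hp : 0 < exp (d + 2 * κ) := exp_pos _
  rw [← mul_le_mul_iff_right₀ hp]
  refine hm.trans (hsq.trans (le_of_eq ?_))
  rw [← exp_add]; congr 1; ring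

lemma stdGaussian_inner_tail {d : ℕ} (v : E d) {κ : ℝ} (hκ : 0 < κ) (hv : v ≠ 0) :
    stdGaussian (E d) {z | 2 * √κ * ‖v‖ ≤ inner ℝ v z} ≤ ENNReal.ofReal (exp (-2 * κ)) := by
  have hmap : (stdGaussian (E d)).map (innerSL ℝ v) =
      gaussianReal 0 (‖v‖ ^ 2).toNNReal := by
    rw [IsGaussian.map_eq_gaussianReal, integral_strongDual_stdGaussian,
      variance_dual_stdGaussian, innerSL_apply_norm]
  have hv' : 0 < ‖v‖ := norm_pos_iff.2 hv
  have hmgf := mgf_gaussianReal hmap (2 * √κ / ‖v‖)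
  have hexpint : Integrable (fun z => exp (2 * √κ / ‖v‖ * innerSL ℝ v z))
      (stdGaussian (E d)) := by
    rw [← mgf_pos_iff, hmgf]; exact exp_pos _
  have := measure_ge_le_exp_mul_mgf (μ := stdGaussian (E d)) (X := innerSL ℝ v)
    (2 * √κ * ‖v‖) (t := 2 * √κ / ‖v‖) (by positivity) hexpint
  rw [hmgf, ← exp_add] at this
  rw [ENNReal.le_ofReal_iff_toReal_le (measure_ne_top _ _) (exp_pos _).le]
  refine this.trans (le_of_eq ?_)
  congr 1
  have hk := sq_sqrt hκ.le
  rw [Real.coe_toNNReal _ (by positivity)]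
  field_simp
  linear_combination (-‖v‖) * hk

/-! ### The typical observations -/

/-- A bounded set has a finite external cover whose cardinality is the external covering number. -/
lemma exists_finset_cover {d : ℕ} {A : Set (E d)} (hA : Bornology.IsBounded A) {r : ℝ}
    (hr : 0 < r) :
    ∃ S : Finset (E d), S.card = (Metric.externalCoveringNumber r.toNNReal A).toNat ∧
      ∀ x ∈ A, ∃ i ∈ S, x ∈ Metric.closedBall i r := by
  have hr' : r.toNNReal ≠ 0 := by simpa using hr
  obtain ⟨C', -, hfin, hC'⟩ := Metric.exists_finite_isCover_of_isCompact_closure hr'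
    hA.isCompact_closure
  have : Nonempty {s : Set (E d) // Metric.IsCover r.toNNReal A s} := ⟨⟨C', hC'⟩⟩
  obtain ⟨C, hC⟩ := ENat.exists_eq_iInf
    (fun C : {s : Set (E d) // Metric.IsCover r.toNNReal A s} ↦ (C : Set (E d)).encard)
  have hCeq : (C : Set (E d)).encard = Metric.externalCoveringNumber r.toNNReal A := by
    rw [hC, Metric.externalCoveringNumber, iInf_subtype]
  have hCfin : (C : Set (E d)).Finite := by
    rw [← Set.encard_lt_top_iff, hCeq]
    exact (Metric.IsCover.externalCoveringNumber_le_encard hC').trans_lt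
      (Set.encard_lt_top_iff.2 hfin)
  refine ⟨hCfin.toFinset, ?_, fun x hx => ?_⟩
  · rw [← hCeq, hCfin.encard_eq_coe_toFinset_card]; rfl
  · have h := Metric.isCover_iff_subset_iUnion_closedBall.1 C.2 hx
    simp only [Set.mem_iUnion, exists_prop] at h
    obtain ⟨i, hi, hxi⟩ := h
    refine ⟨i, by simpa using hi, ?_⟩
    rwa [Real.coe_toNNReal _ hr.le] at hxi

/-- The observations `y` that lie near a centre `i` of the cover `S` whose ball carries a
non-negligible part of `p_X`, and whose noise component `y - i` has the size and the correlations
with the directions `j - i` that are typical for a Gaussian vector of standard deviation `τ`.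
All conditions are closed in `y`, and the true signal does not occur in them. -/
def goodSet {d : ℕ} (pX : Measure (E d)) (S : Finset (E d)) (r τ κ : ℝ) : Set (E d) :=
  {y | ∃ i ∈ S, exp (-2 * κ) ≤ pX.real (Metric.closedBall i r) ∧
    ‖y - i‖ ≤ τ * (2 * √d + 4 * √κ) ∧
    ∀ j ∈ S, inner ℝ (j - i) (y - i) ≤ 3 * τ * √κ * ‖j - i‖}

lemma measurableSet_goodSet {d : ℕ} (pX : Measure (E d)) (S : Finset (E d)) (r τ κ : ℝ) :
    MeasurableSet (goodSet pX S r τ κ) := by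
  have h : goodSet pX S r τ κ = ⋃ i ∈ S, ({y | exp (-2 * κ) ≤ pX.real (Metric.closedBall i r)} ∩
      ({y | ‖y - i‖ ≤ τ * (2 * √d + 4 * √κ)} ∩
        ⋂ j ∈ S, {y | inner ℝ (j - i) (y - i) ≤ 3 * τ * √κ * ‖j - i‖})) := by
    ext y
    simp only [goodSet, Set.mem_ofPred_eq, Set.mem_iUnion, Set.mem_inter_iff, Set.mem_iInter,
      exists_prop]
  rw [h]
  refine Finset.measurableSet_biUnion _ fun i _ => (MeasurableSet.const _).inter
    (IsClosed.measurableSet ?_)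
  refine IsClosed.inter (isClosed_le (by fun_prop) (by fun_prop)) ?_
  exact isClosed_biInter fun j _ => isClosed_le (by fun_prop) (by fun_prop)

lemma noisyLaw_eq_map {d : ℕ} (pX : Measure (E d)) [SFinite pX] (σ : ℝ) :
    noisyLaw pX σ =
      (pX.prod (stdGaussian (E d))).map (fun p => p.1 + σ • p.2) := by
  have h : pX.prod ((stdGaussian (E d)).map (fun z => σ • z)) =
      (pX.prod (stdGaussian (E d))).map (Prod.map id (fun z => σ • z)) := by
    rw [← Measure.map_prod_map _ _ measurable_id (by fun_prop), Measure.map_id]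
  rw [noisyLaw, Measure.conv, h, Measure.map_map (by fun_prop) (by fun_prop)]
  rfl

instance isProbabilityMeasure_noisyLaw {d : ℕ} (pX : Measure (E d)) [IsProbabilityMeasure pX]
    (σ : ℝ) : IsProbabilityMeasure (noisyLaw pX σ) := by
  rw [noisyLaw_eq_map]
  exact Measure.isProbabilityMeasure_map (by fun_prop)

/-- An observation is typical if the signal lies in a ball of non-negligible mass and the noise has
typical size and correlations; replacing the signal by the centre of its ball costs `r ≤ τ`. -/
lemma mem_goodSet_of_signal_noise {d : ℕ} {pX : Measure (E d)} {S : Finset (E d)} {r τ κ : ℝ}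
    (hr : 0 ≤ r) (hrτ : r ≤ τ) (hκ : 1 ≤ κ) {x z i : E d} (hi : i ∈ S)
    (hx : x ∈ Metric.closedBall i r) (hmass : exp (-2 * κ) ≤ pX.real (Metric.closedBall i r))
    (hz : ‖z‖ ^ 2 ≤ 4 * (d + 2 * κ))
    (hin : ∀ j ∈ S, inner ℝ (j - i) z ≤ 2 * √κ * ‖j - i‖) :
    x + τ • z ∈ goodSet pX S r τ κ := by
  have hτ : 0 ≤ τ := hr.trans hrτ
  have hk1 : 1 ≤ √κ := one_le_sqrt.2 hκ
  have hk2 : √κ ^ 2 = κ := sq_sqrt (by linarith)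
  have hd2 : √(d : ℝ) ^ 2 = d := sq_sqrt (by positivity)
  have hxi : ‖x - i‖ ≤ r := by simpa [dist_eq_norm] using hx
  have hxi' : ‖x - i‖ ≤ τ * √κ := by nlinarith
  have e : x + τ • z - i = τ • z + (x - i) := by abel
  refine ⟨i, hi, hmass, ?_, fun j hj => ?_⟩
  · have hz' : ‖z‖ ≤ 2 * √d + 3 * √κ := by
      refine abs_le_of_sq_le_sq' ?_ (by positivity) |>.2
      nlinarith [mul_nonneg (sqrt_nonneg (d : ℝ)) (sqrt_nonneg κ)]
    calc ‖x + τ • z - i‖ ≤ τ * ‖z‖ + ‖x - i‖ := by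
          rw [e]
          refine (norm_add_le _ _).trans_eq ?_
          rw [norm_smul, norm_of_nonneg hτ]
      _ ≤ τ * (2 * √d + 3 * √κ) + τ * √κ := by gcongr
      _ = _ := by ring
  · rw [e, inner_add_right, inner_smul_right]
    have h1 := hin j hj
    have h2 : inner ℝ (j - i) (x - i) ≤ ‖j - i‖ * ‖x - i‖ := real_inner_le_norm _ _
    calc _ ≤ τ * (2 * √κ * ‖j - i‖) + ‖j - i‖ * (τ * √κ) := by gcongr; exact h2.trans (by gcongr)
      _ = _ := by ring

/-- A union bound over at most `N` balls of small mass, the norm of the noise, and the `N²`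
directions between centres. -/
lemma noisyLaw_compl_goodSet_le {d : ℕ} (pX : Measure (E d)) [IsProbabilityMeasure pX]
    {S : Finset (E d)} {r τ κ : ℝ} (hr : 0 ≤ r) (hrτ : r ≤ τ) (hκ : 1 ≤ κ)
    (hS : ∀ x ∈ pX.support, ∃ i ∈ S, x ∈ Metric.closedBall i r) :
    noisyLaw pX τ (goodSet pX S r τ κ)ᶜ ≤
      ENNReal.ofReal (3 * (S.card : ℝ) ^ 2 * exp (-2 * κ)) := by
  classical
  set γ := stdGaussian (E d)
  set e := ENNReal.ofReal (exp (-2 * κ))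
  let A : Set (E d) := pX.supportᶜ ∪ ⋃ i ∈ S.filter
    (fun i => pX.real (Metric.closedBall i r) < exp (-2 * κ)), Metric.closedBall i r
  let B : Set (E d) := {z | 4 * (d + 2 * κ) ≤ ‖z‖ ^ 2}
  let D : Set (E d) := ⋃ p ∈ (S ×ˢ S).filter (fun p => p.1 ≠ p.2),
    {z | 2 * √κ * ‖p.1 - p.2‖ ≤ inner ℝ (p.1 - p.2) z}
  -- the signal lies outside the support or in a ball of small mass, of which there are at most `N`
  have hA : pX A ≤ S.card * e := by
    refine (measure_union_le _ _).trans ?_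
    rw [Measure.measure_compl_support, zero_add]
    refine (measure_biUnion_finset_le _ _).trans ?_
    refine (Finset.sum_le_card_nsmul _ _ e fun i hi => ?_).trans ?_
    · rw [Finset.mem_filter] at hi
      rw [ENNReal.le_ofReal_iff_toReal_le (measure_ne_top _ _) (exp_pos _).le]
      exact hi.2.le
    · rw [nsmul_eq_mul]
      gcongr
      exact Finset.filter_subset _ _
  have hB : γ B ≤ e := stdGaussian_norm_tail d κ
  have hD : γ D ≤ (S.card : ENNReal) ^ 2 * e := by
    refine (measure_biUnion_finset_le _ _).trans ?_
    refine (Finset.sum_le_card_nsmul _ _ e fun p hp => ?_).trans ?_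
    · rw [Finset.mem_filter] at hp
      exact stdGaussian_inner_tail _ (by linarith) (sub_ne_zero.2 hp.2)
    · rw [nsmul_eq_mul]
      gcongr
      calc (((S ×ˢ S).filter (fun p => p.1 ≠ p.2)).card : ENNReal) ≤ ((S ×ˢ S).card : ENNReal) := by
            gcongr; exact Finset.filter_subset _ _
        _ = _ := by rw [Finset.card_product, sq]; push_cast; rfl
  have hsub : (fun p : E d × E d => p.1 + τ • p.2) ⁻¹' (goodSet pX S r τ κ)ᶜ ⊆
      A ×ˢ Set.univ ∪ Set.univ ×ˢ (B ∪ D) := by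
    rintro ⟨x, z⟩ hp
    by_contra hc
    simp only [Set.mem_union, Set.mem_prod, Set.mem_univ, and_true, true_and, not_or] at hc
    obtain ⟨hxA, hzB, hzD⟩ := hc
    apply hp
    have hxs : x ∈ pX.support := by
      by_contra h; exact hxA (Or.inl h)
    obtain ⟨i, hi, hxi⟩ := hS x hxs
    have hz : ‖z‖ ^ 2 ≤ 4 * (d + 2 * κ) := by
      have : ¬ (4 * (d + 2 * κ) ≤ ‖z‖ ^ 2) := hzB
      linarith
    refine mem_goodSet_of_signal_noise hr hrτ hκ hi hxi ?_ hz fun j hj => ?_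
    · by_contra h
      refine hxA (Or.inr ?_)
      simp only [Set.mem_iUnion]
      exact ⟨i, Finset.mem_filter.2 ⟨hi, not_le.1 h⟩, hxi⟩
    · by_cases hij : j = i
      · simp [hij]
      by_contra h
      apply hzD
      simp only [D, Set.mem_iUnion]
      exact ⟨(j, i), Finset.mem_filter.2 ⟨Finset.mem_product.2 ⟨hj, hi⟩, hij⟩, (not_le.1 h).le⟩
  have hcard : 1 ≤ S.card := by
    obtain ⟨x, hx⟩ := Measure.nonempty_support (IsProbabilityMeasure.ne_zero pX)
    obtain ⟨i, hi, -⟩ := hS x hx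
    exact Finset.card_pos.2 ⟨i, hi⟩
  rw [noisyLaw_eq_map, Measure.map_apply (by fun_prop) (measurableSet_goodSet ..).compl]
  refine (measure_mono hsub).trans ((measure_union_le _ _).trans ?_)
  rw [Measure.prod_prod, Measure.prod_prod, measure_univ, measure_univ, mul_one, one_mul]
  have hc2 : (S.card : ENNReal) ≤ (S.card : ENNReal) ^ 2 := by
    exact_mod_cast Nat.le_self_pow two_ne_zero _
  have hc1 : (1 : ENNReal) ≤ (S.card : ENNReal) ^ 2 := by
    exact_mod_cast Nat.one_le_pow _ _ hcard
  calc pX A + γ (B ∪ D) ≤ S.card * e + (e + (S.card : ENNReal) ^ 2 * e) :=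
        add_le_add hA ((measure_union_le _ _).trans (add_le_add hB hD))
    _ ≤ (S.card : ENNReal) ^ 2 * e + ((S.card : ENNReal) ^ 2 * e + (S.card : ENNReal) ^ 2 * e) := by
        gcongr
        exact le_mul_of_one_le_left zero_le hc1
    _ = 3 * (S.card : ENNReal) ^ 2 * e := by ring
    _ = _ := by
        rw [ENNReal.ofReal_mul (by positivity), ENNReal.ofReal_mul (by positivity),
          ENNReal.ofReal_pow (by positivity)]
        simp [e]

/-! ### Gibbs bounds for the posterior of the signal -/

section

section Gibbs

variable {α : Type*} [MeasurableSpace α]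

lemma tilted_add_const (μ : Measure α) (f : α → ℝ) (c : ℝ) :
    μ.tilted (fun x => f x + c) = μ.tilted f := by
  unfold Measure.tilted
  congr 1
  ext x
  simp_rw [exp_add]
  rw [integral_mul_const, mul_div_mul_right _ _ (exp_pos c).ne']

/-- The easy half of the Gibbs variational principle: the mean energy of a Gibbs measure is at most
its free energy, since the relative entropy is nonnegative. -/
lemma integral_tilted_neg_le {μ : Measure α} [IsProbabilityMeasure μ] {g : α → ℝ}
    (hg : AEMeasurable g μ) (hg0 : ∀ᵐ x ∂μ, 0 ≤ g x) :
    ∫ x, g x ∂(μ.tilted (fun x => -g x)) ≤ -log (∫ x, exp (-g x) ∂μ) := by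
  have hE : Integrable (fun x => exp (-g x)) μ := by
    refine Integrable.of_bound (hg.neg.exp.aestronglyMeasurable) 1 ?_
    filter_upwards [hg0] with x hx
    rw [norm_of_nonneg (exp_pos _).le]
    exact exp_le_one_iff.2 (by linarith)
  have hG : Integrable (fun x => exp (-g x) * g x) μ := by
    refine Integrable.of_bound ((hg.neg.exp.mul hg).aestronglyMeasurable) 1 ?_
    filter_upwards [hg0] with x hx
    rw [norm_of_nonneg (by positivity), exp_neg, inv_mul_le_one₀ (exp_pos _)]
    linarith [add_one_le_exp (g x)]
  set Z := ∫ x, exp (-g x) ∂μ with hZ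
  have hZ0 : 0 < Z := integral_exp_pos hE
  rw [integral_tilted]
  simp_rw [smul_eq_mul, ← hZ, div_mul_eq_mul_div]
  rw [integral_div, div_le_iff₀ hZ0]
  -- `t log (t / Z) ≥ t - Z` for `t = exp (-g x)`
  have hpt : ∀ x, exp (-g x) * g x ≤ -log Z * exp (-g x) + (Z - exp (-g x)) := by
    intro x
    have h := add_one_le_exp (g x + log Z)
    rw [exp_add, exp_log hZ0] at h
    have h2 := mul_le_mul_of_nonneg_left h (exp_pos (-g x)).le
    rw [← mul_assoc, ← exp_add, neg_add_cancel, exp_zero, one_mul] at h2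
    linarith
  have := integral_mono hG (((hE.const_mul (-log Z)).add ((integrable_const Z).sub hE))) hpt
  refine this.trans (le_of_eq ?_)
  rw [integral_add' (f := fun x => -log Z * exp (-g x)) (g := (fun _ => Z) - fun x => exp (-g x))
    (hE.const_mul _) ((integrable_const Z).sub hE), integral_sub' (integrable_const Z) hE,
    integral_const_mul]
  simp [← hZ]

end Gibbs

variable {d : ℕ} {pX : Measure (E d)}

lemma ae_norm_le_of_support {R : ℝ} (hR : pX.support ⊆ Metric.closedBall 0 R) :
    ∀ᵐ x ∂pX, ‖x‖ ≤ R := by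
  filter_upwards [Measure.support_mem_ae (μ := pX)] with x hx
  simpa using hR hx

lemma ae_posterior {p : E d → Prop} (h : ∀ᵐ x ∂pX, p x) (ω : ℝ) (y : E d) :
    ∀ᵐ x ∂(posterior pX ω y), p x :=
  (tilted_absolutelyContinuous _ _).ae_le h

lemma ae_norm_sq_sub_le {R : ℝ} (hR : ∀ᵐ x ∂pX, ‖x‖ ≤ R) (y : E d) :
    ∀ᵐ x ∂pX, ‖‖x - y‖ ^ 2‖ ≤ (R + ‖y‖) ^ 2 := by
  filter_upwards [hR] with x hx
  rw [norm_of_nonneg (by positivity)]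
  gcongr
  exact (norm_sub_le _ _).trans (by gcongr)

/-- On the good set the squared distance to `y` is bounded below on the support of `p_X`, and it is
close to that lower bound on a ball of non-negligible mass. -/
lemma norm_sq_bounds_of_mem_goodSet {S : Finset (E d)} {r τ κ : ℝ} (hr : 0 ≤ r)
    (hrτ : r ≤ τ) (hrd : r * √d ≤ τ) (hκ : 1 ≤ κ)
    (hS : ∀ x ∈ pX.support, ∃ i ∈ S, x ∈ Metric.closedBall i r) {y : E d}
    (hy : y ∈ goodSet pX S r τ κ) :
    ∃ (i : E d) (c : ℝ), exp (-2 * κ) ≤ pX.real (Metric.closedBall i r) ∧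
      c ≤ τ ^ 2 * (8 * d + 32 * κ) ∧ (∀ x ∈ pX.support, c ≤ ‖x - y‖ ^ 2) ∧
      ∀ x ∈ Metric.closedBall i r, ‖x - y‖ ^ 2 ≤ c + 40 * τ ^ 2 * κ := by
  obtain ⟨i, hi, hmass, hyi, hin⟩ := hy
  have hτ : 0 ≤ τ := hr.trans hrτ
  have hk1 : 1 ≤ √κ := one_le_sqrt.2 hκ
  have hk2 : √κ ^ 2 = κ := sq_sqrt (by linarith)
  have hd2 : √(d : ℝ) ^ 2 = d := sq_sqrt (by positivity)
  have hry : r * ‖y - i‖ ≤ 6 * τ ^ 2 * κ := by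
    calc r * ‖y - i‖ ≤ r * (τ * (2 * √d + 4 * √κ)) := by gcongr
      _ = τ * (2 * (r * √d) + 4 * (r * √κ)) := by ring
      _ ≤ τ * (2 * (τ * κ) + 4 * (τ * κ)) := by
        have h1 : r * √d ≤ τ * κ := hrd.trans (le_mul_of_one_le_right hτ hκ)
        have h2 : r * √κ ≤ τ * κ := mul_le_mul hrτ (by nlinarith) (sqrt_nonneg κ) hτ
        exact mul_le_mul_of_nonneg_left (by linarith) hτ
      _ = _ := by ring
  refine ⟨i, ‖y - i‖ ^ 2 - 27 * τ ^ 2 * κ, hmass, ?_, fun x hx => ?_, fun x hx => ?_⟩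
  · have h1 : ‖y - i‖ ^ 2 ≤ (τ * (2 * √d + 4 * √κ)) ^ 2 := by gcongr
    have h2 : (2 * √(d : ℝ) + 4 * √κ) ^ 2 ≤ 8 * d + 32 * κ := by
      nlinarith [sq_nonneg (2 * √(d : ℝ) - 4 * √κ)]
    rw [mul_pow] at h1
    have h3 := mul_le_mul_of_nonneg_left h2 (sq_nonneg τ)
    have h4 : 0 ≤ 27 * τ ^ 2 * κ := by positivity
    linarith
  · obtain ⟨j, hj, hxj⟩ := hS x hx
    have hxj' : ‖x - j‖ ≤ r := by simpa [dist_eq_norm] using hxj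
    have e : ‖x - y‖ ^ 2 = ‖x - i‖ ^ 2 - 2 * inner ℝ (x - i) (y - i) + ‖y - i‖ ^ 2 := by
      rw [← norm_sub_sq_real, sub_sub_sub_cancel_right]
    have e2 : inner ℝ (x - i) (y - i) = inner ℝ (x - j) (y - i) + inner ℝ (j - i) (y - i) := by
      rw [← inner_add_left]; congr 1; abel
    have h1 : inner ℝ (x - j) (y - i) ≤ r * ‖y - i‖ :=
      (real_inner_le_norm _ _).trans (by gcongr)
    have h2 : ‖j - i‖ ≤ ‖x - i‖ + r := by
      have : j - i = (x - i) - (x - j) := by abel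
      rw [this]
      exact (norm_sub_le _ _).trans (by gcongr)
    have h3 : 3 * τ * √κ * ‖j - i‖ ≤ 3 * τ * √κ * (‖x - i‖ + r) := by gcongr
    have h4 : τ * √κ * r ≤ τ ^ 2 * κ := by
      have : √κ * r ≤ κ * τ := by
        gcongr
        nlinarith
      nlinarith
    -- completes the square in `‖x - i‖`
    have h5 := sq_nonneg (‖x - i‖ - 3 * τ * √κ)
    have h6 := hin j hj
    have h7 : (τ * √κ) ^ 2 = τ ^ 2 * κ := by rw [mul_pow, hk2]
    nlinarith
  · have hxi : ‖x - i‖ ≤ r := by simpa [dist_eq_norm] using hx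
    have h1 : ‖x - y‖ ≤ r + ‖y - i‖ := by
      have : x - y = (x - i) - (y - i) := by abel
      rw [this]
      exact (norm_sub_le _ _).trans (by gcongr)
    have h2 : ‖x - y‖ ^ 2 ≤ (r + ‖y - i‖) ^ 2 := by gcongr
    have h3 : r ^ 2 ≤ τ ^ 2 * κ := by
      have : r ^ 2 ≤ τ ^ 2 := by gcongr
      nlinarith [sq_nonneg τ]
    nlinarith

variable [IsProbabilityMeasure pX]

lemma integrable_exp_neg_norm_sq (ω : ℝ) (y : E d) :
    Integrable (fun x => exp (-‖x - y‖ ^ 2 / (2 * ω ^ 2))) pX := by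
  refine Integrable.of_bound (by fun_prop) 1 (Filter.Eventually.of_forall fun x => ?_)
  rw [norm_of_nonneg (exp_pos _).le, exp_le_one_iff, neg_div]
  exact neg_nonpos.2 (by positivity)

instance isProbabilityMeasure_posterior (ω : ℝ) (y : E d) :
    IsProbabilityMeasure (posterior pX ω y) :=
  isProbabilityMeasure_tilted (integrable_exp_neg_norm_sq ω y)

lemma integrable_posterior_of_bound {F : Type*} [NormedAddCommGroup F] {φ : E d → F}
    (hφ : StronglyMeasurable φ) {C : ℝ} (hC : ∀ᵐ x ∂pX, ‖φ x‖ ≤ C) (ω : ℝ) (y : E d) :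
    Integrable φ (posterior pX ω y) :=
  Integrable.of_bound hφ.aestronglyMeasurable C (ae_posterior hC ω y)

lemma integrable_norm_sq_sub_posterior {R : ℝ} (hR : ∀ᵐ x ∂pX, ‖x‖ ≤ R) (ω : ℝ) (y : E d) :
    Integrable (fun x => ‖x - y‖ ^ 2) (posterior pX ω y) :=
  integrable_posterior_of_bound (by fun_prop) (ae_norm_sq_sub_le hR y) ω y

lemma integrable_id_posterior {R : ℝ} (hR : ∀ᵐ x ∂pX, ‖x‖ ≤ R) (ω : ℝ) (y : E d) :
    Integrable (fun x => x) (posterior pX ω y) :=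
  integrable_posterior_of_bound (by fun_prop) hR ω y

lemma norm_posteriorMean_le {R : ℝ} (hR : ∀ᵐ x ∂pX, ‖x‖ ≤ R) (ω : ℝ) (y : E d) :
    ‖∫ x, x ∂(posterior pX ω y)‖ ≤ R := by
  have := norm_integral_le_of_norm_le_const (ae_posterior hR ω y)
  simpa using this

/-- The cross-covariance is controlled by the mean excess of the squared distance over any of its
lower bounds; the factor `X - 𝔼 X` is bounded by the diameter of the support. -/
lemma norm_crossCov_le {R : ℝ} (hR0 : 0 ≤ R) (hR : ∀ᵐ x ∂pX, ‖x‖ ≤ R) {ω : ℝ} {y : E d} {c b : ℝ}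
    (hc : ∀ᵐ x ∂pX, c ≤ ‖x - y‖ ^ 2)
    (hb : ∫ x, ‖x - y‖ ^ 2 ∂(posterior pX ω y) ≤ c + b) :
    ‖crossCov pX ω y‖ ≤ 4 * R * b := by
  set m := ∫ x, ‖x - y‖ ^ 2 ∂(posterior pX ω y) with hm
  have hI := integrable_norm_sq_sub_posterior hR ω y
  have hcm : c ≤ m := by
    have := integral_mono_ae (integrable_const c) hI (ae_posterior hc ω y)
    simpa using this
  have hbd : Integrable (fun x => (‖x - y‖ ^ 2 - c + (m - c)) * (2 * R)) (posterior pX ω y) :=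
    ((hI.sub (integrable_const c)).add (integrable_const (m - c))).mul_const _
  rw [crossCov, ← hm]
  refine (norm_integral_le_of_norm_le hbd ?_).trans ?_
  · filter_upwards [ae_posterior hc ω y, ae_posterior hR ω y] with x hx hxR
    rw [norm_smul]
    gcongr
    · rw [norm_eq_abs, abs_le]; constructor <;> linarith
    · refine (norm_sub_le _ _).trans ?_
      linarith [norm_posteriorMean_le hR ω y]
  · have hIc : Integrable (fun x => ‖x - y‖ ^ 2 - c) (posterior pX ω y) :=
      hI.sub (integrable_const c)
    rw [integral_mul_const, integral_add hIc (integrable_const _),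
      integral_sub hI (integrable_const c), ← hm]
    simp only [integral_const, probReal_univ, smul_eq_mul, one_mul]
    nlinarith

/-- The mean energy of the posterior exceeds a lower bound `c` of the energy by little if a ball of
non-negligible mass has energy close to `c`. -/
lemma posterior_norm_sq_le {c b ω κ r : ℝ} {i y : E d} (hω : 0 < ω)
    (hmass : exp (-κ) ≤ pX.real (Metric.closedBall i r))
    (hc : ∀ᵐ x ∂pX, c ≤ ‖x - y‖ ^ 2)
    (hb : ∀ x ∈ Metric.closedBall i r, ‖x - y‖ ^ 2 ≤ c + b)
    (hint : Integrable (fun x => ‖x - y‖ ^ 2) (posterior pX ω y)) :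
    ∫ x, ‖x - y‖ ^ 2 ∂(posterior pX ω y) ≤ c + (2 * ω ^ 2 * κ + b) := by
  set g : E d → ℝ := fun x => (‖x - y‖ ^ 2 - c) / (2 * ω ^ 2) with hg
  -- a Gibbs measure does not change when a constant is added to the energy
  have hpost : posterior pX ω y = pX.tilted (fun x => -g x) := by
    rw [posterior, ← tilted_add_const _ _ (c / (2 * ω ^ 2))]
    congr 1
    ext x
    simp only [hg]
    ring
  have hg0 : ∀ᵐ x ∂pX, 0 ≤ g x := by
    filter_upwards [hc] with x hx
    exact div_nonneg (by linarith) (by positivity)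
  have hG := integral_tilted_neg_le (μ := pX) (g := g) (by fun_prop) hg0
  rw [← hpost] at hG
  have hE : Integrable (fun x => exp (-g x)) pX := by
    refine Integrable.of_bound (by fun_prop) 1 ?_
    filter_upwards [hg0] with x hx
    rw [norm_of_nonneg (exp_pos _).le]
    exact exp_le_one_iff.2 (by linarith)
  have hZ : exp (-κ - b / (2 * ω ^ 2)) ≤ ∫ x, exp (-g x) ∂pX := by
    calc exp (-κ - b / (2 * ω ^ 2)) = exp (-κ) * exp (-(b / (2 * ω ^ 2))) := by
          rw [← exp_add, sub_eq_add_neg]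
      _ ≤ pX.real (Metric.closedBall i r) * exp (-(b / (2 * ω ^ 2))) := by gcongr
      _ = ∫ x in Metric.closedBall i r, exp (-(b / (2 * ω ^ 2))) ∂pX := by
          rw [setIntegral_const, smul_eq_mul]
      _ ≤ ∫ x in Metric.closedBall i r, exp (-g x) ∂pX := by
          refine setIntegral_mono_on (integrable_const _) hE.integrableOn
            Metric.isClosed_closedBall.measurableSet fun x hx => ?_
          rw [exp_le_exp, neg_le_neg_iff]
          simp only [hg]
          gcongr
          linarith [hb x hx]
      _ ≤ _ := setIntegral_le_integral hE (Filter.Eventually.of_forall fun x => (exp_pos _).le)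
  have hlog : -log (∫ x, exp (-g x) ∂pX) ≤ κ + b / (2 * ω ^ 2) := by
    have := log_le_log (exp_pos _) hZ
    rw [log_exp] at this
    linarith
  have hmean : ∫ x, g x ∂(posterior pX ω y) =
      (∫ x, ‖x - y‖ ^ 2 ∂(posterior pX ω y) - c) / (2 * ω ^ 2) := by
    simp only [hg]
    rw [integral_div, integral_sub hint (integrable_const c)]
    simp
  rw [hmean] at hG
  have h := hG.trans hlog
  rw [div_le_iff₀ (by positivity)] at h
  have : (κ + b / (2 * ω ^ 2)) * (2 * ω ^ 2) = 2 * ω ^ 2 * κ + b := by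
    field_simp
  linarith

lemma posterior_bounds_of_mem_goodSet {R : ℝ} (hR : ∀ᵐ x ∂pX, ‖x‖ ≤ R)
    {S : Finset (E d)} {r τ κ : ℝ} (hr : 0 ≤ r) (hrτ : r ≤ τ) (hrd : r * √d ≤ τ) (hκ : 1 ≤ κ)
    (hS : ∀ x ∈ pX.support, ∃ i ∈ S, x ∈ Metric.closedBall i r) {y : E d}
    (hy : y ∈ goodSet pX S r τ κ) :
    ∃ c : ℝ, c ≤ τ ^ 2 * (8 * d + 32 * κ) ∧ (∀ᵐ x ∂pX, c ≤ ‖x - y‖ ^ 2) ∧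
      ∀ ω : ℝ, 0 < ω →
        ∫ x, ‖x - y‖ ^ 2 ∂(posterior pX ω y) ≤ c + 40 * ((τ ^ 2 + ω ^ 2) * κ) := by
  obtain ⟨i, c, hmass, hcle, hc, hb⟩ := norm_sq_bounds_of_mem_goodSet hr hrτ hrd hκ hS hy
  have hc' : ∀ᵐ x ∂pX, c ≤ ‖x - y‖ ^ 2 := by
    filter_upwards [Measure.support_mem_ae (μ := pX)] with x hx using hc x hx
  refine ⟨c, hcle, hc', fun ω hω => ?_⟩
  have := posterior_norm_sq_le hω (by simpa using hmass) hc' hb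
    (integrable_norm_sq_sub_posterior hR ω y)
  have h2 : 0 ≤ ω ^ 2 * κ := by positivity
  linarith

lemma norm_crossCov_le_of_mem_goodSet {R : ℝ} (hR0 : 0 ≤ R) (hR : ∀ᵐ x ∂pX, ‖x‖ ≤ R)
    {S : Finset (E d)} {r τ κ : ℝ} (hr : 0 ≤ r) (hrτ : r ≤ τ) (hrd : r * √d ≤ τ) (hκ : 1 ≤ κ)
    (hS : ∀ x ∈ pX.support, ∃ i ∈ S, x ∈ Metric.closedBall i r) {y : E d}
    (hy : y ∈ goodSet pX S r τ κ) {ω : ℝ} (hω : 0 < ω) :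
    ‖crossCov pX ω y‖ ≤ 160 * R * κ * (τ ^ 2 + ω ^ 2) := by
  obtain ⟨c, -, hc, hb⟩ := posterior_bounds_of_mem_goodSet hR hr hrτ hrd hκ hS hy
  refine (norm_crossCov_le hR0 hR hc (hb ω hω)).trans (le_of_eq ?_)
  ring

lemma posterior_norm_sq_le_of_mem_goodSet {R : ℝ} (hR : ∀ᵐ x ∂pX, ‖x‖ ≤ R)
    {S : Finset (E d)} {r τ κ : ℝ} (hr : 0 ≤ r) (hrτ : r ≤ τ) (hrd : r * √d ≤ τ) (hκ : 1 ≤ κ)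
    (hS : ∀ x ∈ pX.support, ∃ i ∈ S, x ∈ Metric.closedBall i r) {y : E d}
    (hy : y ∈ goodSet pX S r τ κ) {ω : ℝ} (hω : 0 < ω) :
    ∫ x, ‖x - y‖ ^ 2 ∂(posterior pX ω y) ≤ 72 * ((τ ^ 2 + ω ^ 2) * (d + κ)) := by
  obtain ⟨c, hcd, -, hb⟩ := posterior_bounds_of_mem_goodSet hR hr hrτ hrd hκ hS hy
  have h1 : 0 ≤ ω ^ 2 * κ := by positivity
  have h2 : 0 ≤ ω ^ 2 * (d : ℝ) := by positivity
  have h3 : 0 ≤ τ ^ 2 * (d : ℝ) := by positivity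
  linarith [hb ω hω]

end

/-! ### Dependence of the posterior and the score on the noise level -/

section

variable {d : ℕ} {pX : Measure (E d)}

lemma posterior_integral {F : Type*} [NormedAddCommGroup F] [NormedSpace ℝ F] (φ : E d → F)
    (ω : ℝ) (y : E d) :
    ∫ x, φ x ∂(posterior pX ω y) = (∫ x, exp (-‖x - y‖ ^ 2 / (2 * ω ^ 2)) ∂pX)⁻¹ •
      ∫ x, exp (-‖x - y‖ ^ 2 / (2 * ω ^ 2)) • φ x ∂pX := by
  rw [posterior, integral_tilted, ← integral_smul]
  congr 1
  ext x
  rw [smul_smul, div_eq_inv_mul]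

lemma ae_norm_smul_le {R : ℝ} (hR : ∀ᵐ x ∂pX, ‖x‖ ≤ R) (y : E d) :
    ∀ᵐ x ∂pX, ‖‖x - y‖ ^ 2 • x‖ ≤ (R + ‖y‖) ^ 2 * R := by
  filter_upwards [hR, ae_norm_sq_sub_le hR y] with x hx hx2
  rw [norm_smul]
  gcongr

variable [IsProbabilityMeasure pX]

lemma integral_exp_neg_norm_sq_pos (ω : ℝ) (y : E d) :
    0 < ∫ x, exp (-‖x - y‖ ^ 2 / (2 * ω ^ 2)) ∂pX :=
  integral_exp_pos (integrable_exp_neg_norm_sq ω y)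

/-- Differentiation in the noise level `ω` of Gaussian-weighted integrals. -/
lemma hasDerivAt_integral_exp_smul {F : Type*} [NormedAddCommGroup F] [NormedSpace ℝ F]
    {R C : ℝ} (hR : ∀ᵐ x ∂pX, ‖x‖ ≤ R) {φ : E d → F} (hφ : StronglyMeasurable φ)
    (hC : ∀ᵐ x ∂pX, ‖φ x‖ ≤ C) (y : E d) {ω : ℝ} (hω : 0 < ω) :
    HasDerivAt (fun ω : ℝ => ∫ x, exp (-‖x - y‖ ^ 2 / (2 * ω ^ 2)) • φ x ∂pX)
      ((ω ^ 3)⁻¹ • ∫ x, exp (-‖x - y‖ ^ 2 / (2 * ω ^ 2)) • (‖x - y‖ ^ 2 • φ x) ∂pX) ω := by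
  have key := hasDerivAt_integral_of_dominated_loc_of_deriv_le (μ := pX) (𝕜 := ℝ)
    (F := fun (ω : ℝ) x => exp (-‖x - y‖ ^ 2 / (2 * ω ^ 2)) • φ x)
    (F' := fun (ω : ℝ) x => (exp (-‖x - y‖ ^ 2 / (2 * ω ^ 2)) * (‖x - y‖ ^ 2 * (ω ^ 3)⁻¹)) • φ x)
    (x₀ := ω) (s := Set.Ioi (ω / 2)) (bound := fun _ => (R + ‖y‖) ^ 2 * ((ω / 2) ^ 3)⁻¹ * C)
    (Ioi_mem_nhds (by linarith)) ?_ ?_ ?_ ?_ ?_ ?_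
  · have h2 := key.2
    convert h2 using 1
    rw [← integral_smul]
    congr 1
    ext x
    simp only [smul_smul]
    congr 1
    ring
  · exact Filter.Eventually.of_forall fun ω =>
      (StronglyMeasurable.smul (by fun_prop) hφ).aestronglyMeasurable
  · refine Integrable.of_bound (StronglyMeasurable.smul (by fun_prop) hφ).aestronglyMeasurable C ?_
    filter_upwards [hC] with x hx
    rw [norm_smul, norm_of_nonneg (exp_pos _).le]
    refine (mul_le_of_le_one_left (norm_nonneg _) ?_).trans hx
    rw [exp_le_one_iff, neg_div]
    exact neg_nonpos.2 (by positivity)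
  · exact (StronglyMeasurable.smul (by fun_prop) hφ).aestronglyMeasurable
  · filter_upwards [hC, ae_norm_sq_sub_le hR y] with x hx hxR v hv
    have hv' : ω / 2 < v := hv
    have hv0 : 0 < v := by linarith
    rw [norm_smul]
    gcongr
    rw [norm_of_nonneg (by positivity)]
    refine (mul_le_of_le_one_left (by positivity) ?_).trans ?_
    · rw [exp_le_one_iff, neg_div]
      exact neg_nonpos.2 (by positivity)
    · rw [norm_of_nonneg (by positivity)] at hxR
      gcongr
  · exact integrable_const _
  · refine Filter.Eventually.of_forall fun x v hv => ?_
    have hv' : ω / 2 < v := hv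
    have hv0 : v ≠ 0 := by linarith
    refine HasDerivAt.smul_const ?_ _
    have h1 : HasDerivAt (fun v : ℝ => -‖x - y‖ ^ 2 / (2 * v ^ 2))
        (‖x - y‖ ^ 2 * (v ^ 3)⁻¹) v := by
      have h0 : HasDerivAt (fun v : ℝ => 2 * v ^ 2) (2 * (2 * v)) v := by
        simpa using (hasDerivAt_pow 2 v).const_mul 2
      refine ((h0.fun_inv (by positivity)).const_mul (-‖x - y‖ ^ 2)).congr_deriv ?_
      field_simp
    exact h1.exp

lemma continuousOn_integral_exp_smul {F : Type*} [NormedAddCommGroup F] [NormedSpace ℝ F]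
    {R C : ℝ} (hR : ∀ᵐ x ∂pX, ‖x‖ ≤ R) {φ : E d → F} (hφ : StronglyMeasurable φ)
    (hC : ∀ᵐ x ∂pX, ‖φ x‖ ≤ C) (y : E d) :
    ContinuousOn (fun ω : ℝ => ∫ x, exp (-‖x - y‖ ^ 2 / (2 * ω ^ 2)) • φ x ∂pX) (Set.Ioi 0) :=
  fun _ hω => (hasDerivAt_integral_exp_smul hR hφ hC y hω).continuousAt.continuousWithinAt

lemma hasDerivAt_integral_exp {R : ℝ} (hR : ∀ᵐ x ∂pX, ‖x‖ ≤ R) (y : E d) {ω : ℝ} (hω : 0 < ω) :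
    HasDerivAt (fun ω : ℝ => ∫ x, exp (-‖x - y‖ ^ 2 / (2 * ω ^ 2)) ∂pX)
      ((ω ^ 3)⁻¹ * ∫ x, exp (-‖x - y‖ ^ 2 / (2 * ω ^ 2)) * ‖x - y‖ ^ 2 ∂pX) ω := by
  have := hasDerivAt_integral_exp_smul (φ := fun _ => (1 : ℝ)) (C := 1) hR (by fun_prop)
    (by simp) y hω
  simpa using this

lemma continuousOn_posterior_integral {F : Type*} [NormedAddCommGroup F] [NormedSpace ℝ F]
    {R C : ℝ} (hR : ∀ᵐ x ∂pX, ‖x‖ ≤ R) {φ : E d → F} (hφ : StronglyMeasurable φ)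
    (hC : ∀ᵐ x ∂pX, ‖φ x‖ ≤ C) (y : E d) :
    ContinuousOn (fun ω : ℝ => ∫ x, φ x ∂(posterior pX ω y)) (Set.Ioi 0) := by
  simp_rw [posterior_integral]
  refine ContinuousOn.smul (ContinuousOn.inv₀ ?_ fun ω _ => (integral_exp_neg_norm_sq_pos ω y).ne')
    (continuousOn_integral_exp_smul hR hφ hC y)
  exact fun ω hω => (hasDerivAt_integral_exp hR y hω).continuousAt.continuousWithinAt

lemma crossCov_eq {R : ℝ} (hR : ∀ᵐ x ∂pX, ‖x‖ ≤ R) (ω : ℝ) (y : E d) :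
    crossCov pX ω y = ∫ x, ‖x - y‖ ^ 2 • x ∂(posterior pX ω y) -
      (∫ x, ‖x - y‖ ^ 2 ∂(posterior pX ω y)) • ∫ x, x ∂(posterior pX ω y) := by
  set m := ∫ x, ‖x - y‖ ^ 2 ∂(posterior pX ω y)
  set b := ∫ x, x ∂(posterior pX ω y) with hb
  have hf := integrable_norm_sq_sub_posterior hR ω y
  have hx := integrable_id_posterior hR ω y
  have hfx : Integrable (fun x => ‖x - y‖ ^ 2 • x) (posterior pX ω y) :=
    integrable_posterior_of_bound (by fun_prop) (ae_norm_smul_le hR y) ω y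
  have hfm : Integrable (fun x => ‖x - y‖ ^ 2 - m) (posterior pX ω y) :=
    hf.sub (integrable_const m)
  have h0 : ∫ x, (‖x - y‖ ^ 2 - m) ∂(posterior pX ω y) = 0 := by
    rw [integral_sub hf (integrable_const m)]
    simp [m]
  calc crossCov pX ω y
      = ∫ x, ((‖x - y‖ ^ 2 • x - m • x) - (‖x - y‖ ^ 2 - m) • b) ∂(posterior pX ω y) := by
        rw [crossCov]
        congr 1
        ext1 x
        rw [← hb, smul_sub, sub_smul]
    _ = _ := by
        have hmx : Integrable (fun x => m • x) (posterior pX ω y) := hx.smul m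
        have h1 : Integrable (fun x => ‖x - y‖ ^ 2 • x - m • x) (posterior pX ω y) :=
          hfx.sub hmx
        rw [integral_sub h1 (hfm.smul_const b), integral_sub hfx hmx, integral_smul,
          integral_smul_const, h0, zero_smul, sub_zero]

lemma continuousOn_crossCov {R : ℝ} (hR : ∀ᵐ x ∂pX, ‖x‖ ≤ R) (y : E d) :
    ContinuousOn (fun ω : ℝ => crossCov pX ω y) (Set.Ioi 0) := by
  simp_rw [crossCov_eq hR]
  refine (continuousOn_posterior_integral hR (by fun_prop) (ae_norm_smul_le hR y) y).sub
    (ContinuousOn.fun_smul ?_ ?_)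
  · exact continuousOn_posterior_integral hR (by fun_prop) (ae_norm_sq_sub_le hR y) y
  · exact continuousOn_posterior_integral hR (by fun_prop) hR y

/-- The posterior mean moves with the noise level at the rate `W_ω / ω³`. -/
lemma hasDerivAt_posteriorMean {R : ℝ} (hR : ∀ᵐ x ∂pX, ‖x‖ ≤ R) (y : E d) {ω : ℝ} (hω : 0 < ω) :
    HasDerivAt (fun ω : ℝ => ∫ x, x ∂(posterior pX ω y)) ((ω ^ 3)⁻¹ • crossCov pX ω y) ω := by
  simp_rw [crossCov_eq hR, posterior_integral]
  have hZ := (integral_exp_neg_norm_sq_pos (pX := pX) ω y).ne'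
  have h1 := (hasDerivAt_integral_exp hR y hω).fun_inv hZ
  have h2 := hasDerivAt_integral_exp_smul (φ := fun x => x) hR (by fun_prop) hR y hω
  refine (h1.fun_smul h2).congr_deriv ?_
  simp only [smul_eq_mul, smul_sub, smul_smul]
  rw [sub_eq_add_neg, ← neg_smul]
  congr 2
  · ring
  · field_simp

lemma hasGradientAt_integral_exp {R : ℝ} (hR : ∀ᵐ x ∂pX, ‖x‖ ≤ R) (σ : ℝ) (y : E d) :
    HasGradientAt (fun z => ∫ x, exp (-‖x - z‖ ^ 2 / (2 * σ ^ 2)) ∂pX)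
      ((σ ^ 2)⁻¹ • ∫ x, exp (-‖x - y‖ ^ 2 / (2 * σ ^ 2)) • (x - y) ∂pX) y := by
  rw [hasGradientAt_iff_hasFDerivAt]
  have hexp : ∀ x z : E d, exp (-‖x - z‖ ^ 2 / (2 * σ ^ 2)) ≤ 1 := fun x z => by
    rw [exp_le_one_iff, neg_div]
    exact neg_nonpos.2 (by positivity)
  have key := hasFDerivAt_integral_of_dominated_of_fderiv_le (μ := pX) (𝕜 := ℝ)
    (F := fun (z : E d) x => exp (-‖x - z‖ ^ 2 / (2 * σ ^ 2)))
    (F' := fun (z : E d) x => innerSL ℝ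
      (((σ ^ 2)⁻¹ * exp (-‖x - z‖ ^ 2 / (2 * σ ^ 2))) • (x - z)))
    (x₀ := y) (s := Metric.ball y 1) (bound := fun _ => ((σ ^ 2)⁻¹ * 1) * (R + (‖y‖ + 1)))
    (Metric.ball_mem_nhds _ one_pos) ?_ (integrable_exp_neg_norm_sq σ y) ?_ ?_ ?_ ?_
  · refine key.congr_fderiv ?_
    rw [ContinuousLinearMap.integral_comp_comm]
    · simp_rw [mul_smul]
      rw [integral_smul]
      rfl
    · refine Integrable.of_bound (by fun_prop) (((σ ^ 2)⁻¹ * 1) * (R + ‖y‖)) ?_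
      filter_upwards [hR] with x hx
      rw [norm_smul, norm_of_nonneg (by positivity)]
      gcongr
      · exact hexp x y
      · exact (norm_sub_le _ _).trans (by gcongr)
  · exact Filter.Eventually.of_forall fun z => by fun_prop
  · refine Continuous.aestronglyMeasurable ?_
    fun_prop
  · filter_upwards [hR] with x hx z hz
    rw [innerSL_apply_norm, norm_smul, norm_of_nonneg (by positivity)]
    gcongr
    · exact hexp x z
    · refine (norm_sub_le _ _).trans ?_
      have : ‖z‖ ≤ ‖y‖ + 1 := by
        have h1 : ‖z - y‖ < 1 := by simpa [dist_eq_norm] using hz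
        have h2 := norm_sub_norm_le z y
        linarith
      gcongr
  · exact integrable_const _
  · refine Filter.Eventually.of_forall fun x z _ => ?_
    have h1 : HasFDerivAt (fun z : E d => x - z) (-ContinuousLinearMap.id ℝ (E d)) z :=
      (hasFDerivAt_id z).const_sub x
    have h2 := ((h1.norm_sq.const_mul (-(2 * σ ^ 2)⁻¹)).exp)
    have e : (fun z : E d => exp (-(2 * σ ^ 2)⁻¹ * ‖x - z‖ ^ 2)) =
        fun z => exp (-‖x - z‖ ^ 2 / (2 * σ ^ 2)) := by
      ext z; congr 1; ring
    rw [e] at h2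
    refine h2.congr_fderiv ?_
    ext v
    have e2 : -(2 * σ ^ 2)⁻¹ * ‖x - z‖ ^ 2 = -‖x - z‖ ^ 2 / (2 * σ ^ 2) := by ring
    rw [e2, mul_inv]
    simp
    ring

lemma noisyDensity_pos {σ : ℝ} (hσ : 0 < σ) (y : E d) : 0 < noisyDensity pX σ y :=
  mul_pos (by positivity) (integral_exp_neg_norm_sq_pos σ y)

/-- Tweedie's formula: the scaled score is the posterior mean minus the observation. -/
lemma score_eq {R : ℝ} (hR : ∀ᵐ x ∂pX, ‖x‖ ≤ R) {σ : ℝ} (hσ : 0 < σ) (y : E d) :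
    score pX σ y = ∫ x, x ∂(posterior pX σ y) - y := by
  set a := ((2 * π * σ ^ 2) ^ ((d : ℝ) / 2))⁻¹ with ha
  have ha0 : 0 < a := by positivity
  set Z := ∫ x, exp (-‖x - y‖ ^ 2 / (2 * σ ^ 2)) ∂pX with hZ
  have hZ0 : 0 < Z := integral_exp_neg_norm_sq_pos σ y
  have hx := integrable_id_posterior hR σ y
  have hg := (hasGradientAt_iff_hasFDerivAt.1 (hasGradientAt_integral_exp hR σ y))
  have h1 := (hg.const_mul a).log (mul_pos ha0 hZ0).ne'
  have h2 : HasGradientAt (fun z => log (noisyDensity pX σ z))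
      ((a * Z)⁻¹ • a • ((σ ^ 2)⁻¹ • ∫ x, exp (-‖x - y‖ ^ 2 / (2 * σ ^ 2)) • (x - y) ∂pX)) y := by
    rw [hasGradientAt_iff_hasFDerivAt]
    refine h1.congr_fderiv ?_
    ext w
    simp [hZ]
  rw [score, h2.gradient]
  have h3 : ∫ x, (x - y) ∂(posterior pX σ y) = ∫ x, x ∂(posterior pX σ y) - y := by
    rw [integral_sub hx (integrable_const y)]
    simp
  rw [← h3, posterior_integral, ← hZ, smul_smul, smul_smul, smul_smul]
  congr 1
  field_simp

end

/-! ### The mismatch error and the posterior of the noise level -/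

section

lemma isProbabilityMeasure_normalize {α : Type*} [MeasurableSpace α] {m : Measure α}
    (h0 : m Set.univ ≠ 0) (h1 : m Set.univ ≠ ⊤) : IsProbabilityMeasure (normalize m) :=
  ⟨by rw [normalize, Measure.smul_apply, smul_eq_mul, ENNReal.inv_mul_cancel h0 h1]⟩

variable {d : ℕ} {pX : Measure (E d)} {Θ : Measure ℝ} {σT σ0 : ℝ}

lemma ae_mem_Icc_noisePosterior (hΘ : Θ (Set.Icc σT σ0)ᶜ = 0) (y : E d) :
    ∀ᵐ σ ∂(noisePosterior pX Θ y), σ ∈ Set.Icc σT σ0 := by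
  have h : ∀ᵐ σ ∂Θ, σ ∈ Set.Icc σT σ0 := hΘ
  exact Measure.ae_smul_measure ((withDensity_absolutelyContinuous _ _).ae_le h) _

variable [IsProbabilityMeasure pX]

lemma measurable_noisyDensity (y : E d) : Measurable (fun σ : ℝ => noisyDensity pX σ y) := by
  refine Measurable.mul (by fun_prop) ?_
  refine StronglyMeasurable.measurable ?_
  refine StronglyMeasurable.integral_prod_right
    (f := fun (σ : ℝ) (x : E d) => exp (-‖x - y‖ ^ 2 / (2 * σ ^ 2))) ?_
  refine Measurable.stronglyMeasurable ?_
  unfold Function.uncurry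
  fun_prop

lemma integral_exp_le_one (σ : ℝ) (y : E d) :
    ∫ x, exp (-‖x - y‖ ^ 2 / (2 * σ ^ 2)) ∂pX ≤ 1 := by
  have := integral_mono (integrable_exp_neg_norm_sq σ y) (integrable_const (μ := pX) (1 : ℝ))
    (fun x => by
      change exp (-‖x - y‖ ^ 2 / (2 * σ ^ 2)) ≤ 1
      rw [exp_le_one_iff, neg_div]
      exact neg_nonpos.2 (by positivity))
  simpa using this

lemma noisyDensity_le {σ : ℝ} (hT : 0 < σT) (hσ : σT ≤ σ) (y : E d) :
    noisyDensity pX σ y ≤ ((2 * π * σT ^ 2) ^ ((d : ℝ) / 2))⁻¹ := by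
  have h0 : 0 < σ := hT.trans_le hσ
  have h : (2 * π * σT ^ 2) ^ ((d : ℝ) / 2) ≤ (2 * π * σ ^ 2) ^ ((d : ℝ) / 2) := by gcongr
  calc noisyDensity pX σ y ≤ ((2 * π * σ ^ 2) ^ ((d : ℝ) / 2))⁻¹ * 1 := by
        unfold noisyDensity
        gcongr
        exact integral_exp_le_one σ y
    _ ≤ _ := by
        rw [mul_one]
        exact inv_anti₀ (by positivity) h

lemma isProbabilityMeasure_noisePosterior [IsProbabilityMeasure Θ] (hT : 0 < σT)
    (hΘ : Θ (Set.Icc σT σ0)ᶜ = 0) (y : E d) :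
    IsProbabilityMeasure (noisePosterior pX Θ y) := by
  have h : ∀ᵐ σ ∂Θ, σ ∈ Set.Icc σT σ0 := hΘ
  apply isProbabilityMeasure_normalize
  · rw [withDensity_apply _ MeasurableSet.univ, Measure.restrict_univ, Ne,
      lintegral_eq_zero_iff (measurable_noisyDensity y).ennreal_ofReal]
    intro h0
    have : ∀ᵐ σ ∂Θ, False := by
      filter_upwards [h, h0] with σ hσ hσ0
      have h1 := noisyDensity_pos (pX := pX) (hT.trans_le hσ.1) y
      simp only [Pi.zero_apply, ENNReal.ofReal_eq_zero] at hσ0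
      linarith
    rw [Filter.eventually_false_iff_eq_bot, ae_eq_bot] at this
    exact IsProbabilityMeasure.ne_zero Θ this
  · rw [withDensity_apply _ MeasurableSet.univ, Measure.restrict_univ]
    refine ne_top_of_le_ne_top (b := ∫⁻ _, ENNReal.ofReal
      ((2 * π * σT ^ 2) ^ ((d : ℝ) / 2))⁻¹ ∂Θ) (by simp) (lintegral_mono_ae ?_)
    filter_upwards [h] with σ hσ
    exact ENNReal.ofReal_le_ofReal (noisyDensity_le hT hσ.1 y)

lemma score_sub_score {R : ℝ} (hR : ∀ᵐ x ∂pX, ‖x‖ ≤ R) {σ τ : ℝ} (hσ : 0 < σ) (hτ : 0 < τ)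
    (y : E d) :
    score pX τ y - score pX σ y = ∫ ω in σ..τ, (ω ^ 3)⁻¹ • crossCov pX ω y := by
  have hpos : ∀ ω ∈ Set.uIcc σ τ, 0 < ω := fun ω hω =>
    (lt_min hσ hτ).trans_le hω.1
  rw [intervalIntegral.integral_eq_sub_of_hasDerivAt
    (f := fun ω => ∫ x, x ∂(posterior pX ω y))
    (fun ω hω => hasDerivAt_posteriorMean hR y (hpos ω hω)), score_eq hR hτ, score_eq hR hσ]
  · abel
  · refine ContinuousOn.intervalIntegrable (ContinuousOn.fun_smul ?_ ?_)
    · exact ContinuousOn.inv₀ (by fun_prop) fun ω hω => (pow_pos (hpos ω hω) 3).ne'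
    · exact (continuousOn_crossCov hR y).mono hpos

lemma norm_score_sub_score_le {R : ℝ} (hR : ∀ᵐ x ∂pX, ‖x‖ ≤ R) {σ τ : ℝ} (hσ : 0 < σ)
    (hτ : 0 < τ) (y : E d) :
    ‖score pX τ y - score pX σ y‖ ≤ |∫ ω in σ..τ, ‖crossCov pX ω y‖ * (ω ^ 3)⁻¹| := by
  have hpos : ∀ ω ∈ Set.uIcc σ τ, 0 < ω := fun ω hω =>
    (lt_min hσ hτ).trans_le hω.1
  rw [score_sub_score hR hσ hτ]
  refine (intervalIntegral.norm_integral_le_abs_integral_norm).trans (le_of_eq ?_)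
  congr 1
  refine intervalIntegral.integral_congr fun ω hω => ?_
  have := hpos ω hω
  change ‖(ω ^ 3)⁻¹ • crossCov pX ω y‖ = ‖crossCov pX ω y‖ * (ω ^ 3)⁻¹
  rw [norm_smul, norm_of_nonneg (by positivity), mul_comm]

lemma continuousOn_score {R : ℝ} (hR : ∀ᵐ x ∂pX, ‖x‖ ≤ R) (y : E d) :
    ContinuousOn (fun σ => score pX σ y) (Set.Ioi 0) := by
  refine ContinuousOn.congr
    (f := fun σ => ∫ x, x ∂(posterior pX σ y) - y) ?_ fun σ hσ => score_eq hR hσ y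
  exact (continuousOn_posterior_integral hR (by fun_prop) hR y).sub continuousOn_const

/-- Jensen's inequality for the squared norm. -/
lemma enorm_integral_sq_le {α F : Type*} [MeasurableSpace α] [NormedAddCommGroup F]
    [NormedSpace ℝ F] {μ : Measure α} [IsProbabilityMeasure μ] {f : α → F}
    (hf : AEStronglyMeasurable f μ) :
    ‖∫ x, f x ∂μ‖ₑ ^ 2 ≤ ∫⁻ x, ‖f x‖ₑ ^ 2 ∂μ := by
  have h1 : ‖∫ x, f x ∂μ‖ₑ ≤ ∫⁻ x, ‖f x‖ₑ ∂μ := enorm_integral_le_lintegral_enorm f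
  have h2 := eLpNorm_le_eLpNorm_of_exponent_le (μ := μ) (p := 1) (q := 2) (by norm_num) hf
  rw [eLpNorm_one_eq_lintegral_enorm] at h2
  calc ‖∫ x, f x ∂μ‖ₑ ^ 2 ≤ (eLpNorm f 2 μ) ^ 2 := by gcongr; exact h1.trans h2
    _ = _ := by
      rw [eLpNorm_eq_lintegral_rpow_enorm_toReal (by norm_num) (by norm_num)]
      simp only [ENNReal.toReal_ofNat, ENNReal.rpow_ofNat]
      rw [← ENNReal.rpow_natCast, ← ENNReal.rpow_mul]
      norm_num

lemma mismatchError_le_crossCovError [IsProbabilityMeasure Θ] {R : ℝ}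
    (hR : ∀ᵐ x ∂pX, ‖x‖ ≤ R) (hT : 0 < σT) (hΘ : Θ (Set.Icc σT σ0)ᶜ = 0) {τ : ℝ} (hτ : 0 < τ) :
    mismatchError pX Θ τ ≤ crossCovError pX Θ τ := by
  refine lintegral_mono fun y => ?_
  have := isProbabilityMeasure_noisePosterior (pX := pX) hT hΘ y
  set μ := noisePosterior pX Θ y with hμ
  have hae := ae_mem_Icc_noisePosterior (pX := pX) hΘ y
  have hmeas : AEStronglyMeasurable (fun σ => score pX σ y) μ := by
    have : μ.restrict (Set.Icc σT σ0) = μ := Measure.restrict_eq_self_of_ae_mem hae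
    rw [← this]
    exact ((continuousOn_score hR y).mono fun σ hσ => hT.trans_le hσ.1).aestronglyMeasurable
      measurableSet_Icc
  have hint : Integrable (fun σ => score pX σ y) μ := by
    refine Integrable.of_bound hmeas (R + ‖y‖) ?_
    filter_upwards [hae] with σ hσ
    rw [score_eq hR (hT.trans_le hσ.1)]
    exact (norm_sub_le _ _).trans (by gcongr; exact norm_posteriorMean_le hR σ y)
  -- the posterior of the noise level has mass one, so the score at `τ` goes under the integral
  have e : score pX τ y - blindScore pX Θ y = ∫ σ, (score pX τ y - score pX σ y) ∂μ := by
    rw [integral_sub (integrable_const _) hint]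
    simp [blindScore, hμ]
  rw [e, ENNReal.ofReal_pow (norm_nonneg _), ofReal_norm]
  refine (enorm_integral_sq_le (aestronglyMeasurable_const.sub hmeas)).trans ?_
  refine lintegral_mono_ae ?_
  filter_upwards [hae] with σ hσ
  rw [← ofReal_norm, ← ENNReal.ofReal_pow (norm_nonneg _)]
  refine ENNReal.ofReal_le_ofReal ?_
  gcongr
  exact norm_score_sub_score_le hR (hT.trans_le hσ.1) hτ y

end

/-! ### Integration over the observations -/

section

lemma six_le_exp_two : 6 ≤ exp 2 := by
  have h := exp_one_gt_d9
  have h2 : exp 2 = exp 1 * exp 1 := by rw [← exp_add]; norm_num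
  nlinarith

/-- The high-probability events: up to probability `exp (-2 (κ - k)) / 2`, the posteriors at all
noise levels `ω` satisfy the cross-covariance bound and the energy bound at confidence level
`κ`. -/
lemma exists_good_events {d : ℕ} (hd : 0 < d) (pX : Measure (E d)) [IsProbabilityMeasure pX]
    {R σT σ0 τ : ℝ} (hR0 : 0 ≤ R) (hR : pX.support ⊆ Metric.closedBall 0 R) (hT : 0 < σT)
    (h0 : σT < σ0) (hτ : τ ∈ Set.Icc σT σ0) :
    1 ≤ intrinsicDim pX σT σ0 ∧ ∃ G : ℝ → Set (E d), (∀ κ, MeasurableSet (G κ)) ∧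
      ∀ κ, 1 ≤ κ →
        noisyLaw pX τ (G κ)ᶜ ≤ ENNReal.ofReal (exp (-2 * (κ - intrinsicDim pX σT σ0)) / 2) ∧
        ∀ y ∈ G κ, ∀ ω : ℝ, 0 < ω →
          ‖crossCov pX ω y‖ ≤ 160 * R * κ * (τ ^ 2 + ω ^ 2) ∧
          ∫ x, ‖x - y‖ ^ 2 ∂(posterior pX ω y) ≤ 72 * ((τ ^ 2 + ω ^ 2) * (d + κ)) := by
  set r := σT ^ 2 / (σ0 * √d) with hr
  have hσ0 : 0 < σ0 := hT.trans h0
  have hd1 : 1 ≤ √(d : ℝ) := one_le_sqrt.2 (by exact_mod_cast hd)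
  have hr0 : 0 < r := by positivity
  have hrd : r * √d ≤ τ := by
    have : r * √d = σT ^ 2 / σ0 := by rw [hr]; field_simp
    rw [this, div_le_iff₀ hσ0]
    nlinarith [hτ.1]
  have hrτ : r ≤ τ := (le_mul_of_one_le_right hr0.le hd1).trans hrd
  have hRae := ae_norm_le_of_support hR
  obtain ⟨S, hcard, hS⟩ := exists_finset_cover (Metric.isBounded_closedBall.subset hR) hr0
  have hN : 1 ≤ S.card := by
    obtain ⟨x, hx⟩ := Measure.nonempty_support (IsProbabilityMeasure.ne_zero pX)
    obtain ⟨i, hi, -⟩ := hS x hx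
    exact Finset.card_pos.2 ⟨i, hi⟩
  have hN' : (1 : ℝ) ≤ S.card := by exact_mod_cast hN
  have hk : intrinsicDim pX σT σ0 = 1 + log S.card := by
    rw [intrinsicDim, intrinsicDimAt, hcard]
  refine ⟨by rw [hk]; linarith [log_nonneg hN'], goodSet pX S r τ,
    fun κ => measurableSet_goodSet .., fun κ hκ => ⟨?_, fun y hy ω hω => ⟨?_, ?_⟩⟩⟩
  · refine (noisyLaw_compl_goodSet_le pX hr0.le hrτ hκ hS).trans (ENNReal.ofReal_le_ofReal ?_)
    have e : exp (-2 * (κ - intrinsicDim pX σT σ0)) = exp 2 * (S.card : ℝ) ^ 2 * exp (-2 * κ) := by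
      have : (S.card : ℝ) ^ 2 = exp (2 * log S.card) := by
        rw [two_mul, exp_add, exp_log (by linarith), sq]
      rw [this, ← exp_add, ← exp_add, hk]
      congr 1
      ring
    rw [e]
    have h1 : 0 ≤ (S.card : ℝ) ^ 2 * exp (-2 * κ) := by positivity
    nlinarith [six_le_exp_two]
  · exact norm_crossCov_le_of_mem_goodSet hR0 hRae hr0.le hrτ hrd hκ hS hy hω
  · exact posterior_norm_sq_le_of_mem_goodSet hRae hr0.le hrτ hrd hκ hS hy hω

/-- This integral produces the two terms of the noise moment. -/
lemma integral_sq_add_sq_mul_inv_cube {σ τ : ℝ} (hσ : 0 < σ) (hτ : 0 < τ) :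
    ∫ ω in σ..τ, (τ ^ 2 + ω ^ 2) * (ω ^ 3)⁻¹ =
      -(1 - τ ^ 2 / σ ^ 2) / 2 + log (τ / σ) := by
  have hpos : ∀ ω ∈ Set.uIcc σ τ, 0 < ω := fun ω hω => (lt_min hσ hτ).trans_le hω.1
  rw [intervalIntegral.integral_eq_sub_of_hasDerivAt
    (f := fun ω => -τ ^ 2 / 2 * (ω ^ 2)⁻¹ + log ω)]
  · rw [log_div hτ.ne' hσ.ne']
    field_simp
    ring
  · intro ω hω
    have h := (hpos ω hω).ne'
    have h1 : HasDerivAt (fun v : ℝ => v ^ 2) (2 * ω) ω := by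
      simpa using hasDerivAt_pow 2 ω
    refine (((h1.fun_inv (by positivity)).const_mul (-τ ^ 2 / 2)).fun_add
      (hasDerivAt_log h)).congr_deriv ?_
    field_simp
  · refine ContinuousOn.intervalIntegrable (ContinuousOn.mul (by fun_prop) ?_)
    exact ContinuousOn.inv₀ (by fun_prop) fun ω hω => (pow_pos (hpos ω hω) 3).ne'

variable {d : ℕ} {pX : Measure (E d)}

lemma sq_integral_crossCov_le {A σ τ : ℝ} (hσ : 0 < σ) (hτ : 0 < τ) {y : E d}
    (hA : ∀ ω : ℝ, 0 < ω → ‖crossCov pX ω y‖ ≤ A * (τ ^ 2 + ω ^ 2)) :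
    |∫ ω in σ..τ, ‖crossCov pX ω y‖ * (ω ^ 3)⁻¹| ^ 2 ≤
      2 * A ^ 2 * (|1 - τ ^ 2 / σ ^ 2| ^ 2 + |log (τ / σ)| ^ 2) := by
  have hpos : ∀ ω ∈ Set.uIcc σ τ, 0 < ω := fun ω hω => (lt_min hσ hτ).trans_le hω.1
  have hint : IntervalIntegrable (fun ω : ℝ => A * ((τ ^ 2 + ω ^ 2) * (ω ^ 3)⁻¹)) volume σ τ := by
    refine ContinuousOn.intervalIntegrable
      (continuousOn_const.mul (ContinuousOn.mul (by fun_prop) ?_))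
    exact ContinuousOn.inv₀ (by fun_prop) fun ω hω => (pow_pos (hpos ω hω) 3).ne'
  have h1 : ‖∫ ω in σ..τ, ‖crossCov pX ω y‖ * (ω ^ 3)⁻¹‖ ≤
      |∫ ω in σ..τ, A * ((τ ^ 2 + ω ^ 2) * (ω ^ 3)⁻¹)| := by
    refine intervalIntegral.norm_integral_le_abs_of_norm_le ?_ hint
    refine (ae_restrict_mem measurableSet_uIoc).mono fun ω hω => ?_
    have hω0 := hpos ω (Set.uIoc_subset_uIcc hω)
    rw [norm_of_nonneg (by positivity), ← mul_assoc]
    gcongr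
    exact hA ω hω0
  rw [norm_eq_abs] at h1
  have h2 : |∫ ω in σ..τ, ‖crossCov pX ω y‖ * (ω ^ 3)⁻¹| ^ 2 ≤
      |∫ ω in σ..τ, A * ((τ ^ 2 + ω ^ 2) * (ω ^ 3)⁻¹)| ^ 2 := by gcongr
  refine h2.trans ?_
  rw [intervalIntegral.integral_const_mul, integral_sq_add_sq_mul_inv_cube hσ hτ]
  simp only [sq_abs]
  rw [mul_pow, mul_comm 2, mul_assoc]
  refine mul_le_mul_of_nonneg_left ?_ (sq_nonneg A)
  nlinarith [sq_nonneg (-(1 - τ ^ 2 / σ ^ 2) / 2 - log (τ / σ)), sq_nonneg (1 - τ ^ 2 / σ ^ 2)]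

lemma abs_log_div_le {c a b : ℝ} (hc : 0 < c) (ha : c ≤ a) (hb : c ≤ b) :
    |log (b / a)| ≤ |b - a| / c := by
  have key : ∀ a b : ℝ, c ≤ a → c ≤ b → log (b / a) ≤ |b - a| / c := by
    intro a b ha hb
    have ha0 : 0 < a := hc.trans_le ha
    have h := log_le_sub_one_of_pos (div_pos (hc.trans_le hb) ha0)
    have e : b / a - 1 = (b - a) / a := by field_simp
    calc log (b / a) ≤ (b - a) / a := by rw [← e]; exact h
      _ ≤ |b - a| / a := by gcongr; exact le_abs_self _
      _ ≤ |b - a| / c := by gcongr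
  rw [abs_le']
  refine ⟨key a b ha hb, ?_⟩
  rw [← log_inv, inv_div, abs_sub_comm]
  exact key b a hb ha

lemma le_abs_log_div {c a b : ℝ} (ha0 : 0 < a) (ha : a ≤ c) (hb0 : 0 < b) (hb : b ≤ c) :
    |b - a| / c ≤ |log (b / a)| := by
  have key : ∀ a b : ℝ, 0 < a → 0 < b → b ≤ c → a ≤ b → |b - a| / c ≤ |log (b / a)| := by
    intro a b ha0 hb0 hb hab
    have h := one_sub_inv_le_log_of_pos (div_pos hb0 ha0)
    have e : 1 - (b / a)⁻¹ = (b - a) / b := by field_simp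
    rw [abs_of_nonneg (sub_nonneg.2 hab)]
    calc (b - a) / c ≤ (b - a) / b := by
          have := sub_nonneg.2 hab
          gcongr
      _ ≤ log (b / a) := by rw [← e]; exact h
      _ ≤ _ := le_abs_self _
  rcases le_total a b with h | h
  · exact key a b ha0 hb0 hb h
  · rw [abs_sub_comm, ← abs_neg (log _), ← log_inv, inv_div]
    exact key b a hb0 ha0 ha h

/-- The factor `(σ0 - σT)²` matters: the lower bound for the noise moment under a power law prior
also vanishes at this rate as `σT` tends to `σ0`. -/
lemma noise_integrand_le {σT σ0 σ τ : ℝ} (hT : 0 < σT) (hσ : σ ∈ Set.Icc σT σ0)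
    (hτ : τ ∈ Set.Icc σT σ0) :
    |1 - τ ^ 2 / σ ^ 2| ^ 2 + |log (τ / σ)| ^ 2 ≤ 5 * (σ0 - σT) ^ 2 * σ0 ^ 2 / σT ^ 4 := by
  obtain ⟨hσ1, hσ2⟩ := hσ
  obtain ⟨hτ1, hτ2⟩ := hτ
  have hσ0 : 0 < σ := hT.trans_le hσ1
  have hτ0 : 0 < τ := hT.trans_le hτ1
  have hs0 : 0 < σ0 := hσ0.trans_le hσ2
  set D := σ0 - σT
  have hD : |σ - τ| ≤ D := by rw [abs_le]; constructor <;> simp only [D] <;> linarith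
  have hD0 : 0 ≤ D := (abs_nonneg _).trans hD
  have h1 : |1 - τ ^ 2 / σ ^ 2| ≤ 2 * D * σ0 / σT ^ 2 := by
    have e : 1 - τ ^ 2 / σ ^ 2 = (σ - τ) * (σ + τ) / σ ^ 2 := by field_simp; ring
    rw [e, abs_div, abs_mul, abs_of_pos (by positivity : 0 < σ + τ),
      abs_of_pos (by positivity : 0 < σ ^ 2)]
    calc |σ - τ| * (σ + τ) / σ ^ 2 ≤ D * (σ0 + σ0) / σT ^ 2 := by gcongr
      _ = _ := by ring
  have h2 : |log (τ / σ)| ≤ D / σT := by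
    refine (abs_log_div_le hT hσ1 hτ1).trans ?_
    rw [abs_sub_comm]
    gcongr
  have h3 : D / σT ≤ D * σ0 / σT ^ 2 := by
    rw [div_le_div_iff₀ hT (by positivity)]
    have : D * σT * σT ≤ D * σT * σ0 := by gcongr; linarith
    nlinarith
  calc _ ≤ (2 * D * σ0 / σT ^ 2) ^ 2 + (D * σ0 / σT ^ 2) ^ 2 := by
        gcongr; exact h2.trans h3
    _ = _ := by field_simp; ring

/-- Integration of a multiplicative bound whose constant grows along a sequence of events of
probability tending to one: the first constant is paid on the whole space, the later ones only on
the complements of the preceding events. The integrands need not be measurable. -/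
lemma lintegral_le_of_events {α : Type*} [MeasurableSpace α] {ν : Measure α} {f g : α → ENNReal}
    {G : ℕ → Set α} {a p : ℕ → ENNReal} {b : ENNReal} (hG : ∀ n, MeasurableSet (G n))
    (hp : ∀ n, ν (G n)ᶜ ≤ p n) (hp0 : Filter.Tendsto p Filter.atTop (nhds 0)) (ha : a 0 ≠ ⊤)
    (hf : ∀ n, ∀ y ∈ G n, f y ≤ a n * g y) (hg : ∀ y, g y ≤ b) :
    ∫⁻ y, f y ∂ν ≤ a 0 * ∫⁻ y, g y ∂ν + ∑' n, a (n + 1) * b * p n := by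
  have hae : ∀ᵐ y ∂ν, ∃ n, y ∈ G n := by
    rw [ae_iff]
    refine le_antisymm (ge_of_tendsto' hp0 fun n => ?_) zero_le
    refine (measure_mono fun y hy => ?_).trans (hp n)
    exact fun h => hy ⟨n, h⟩
  have hpt : ∀ᵐ y ∂ν, f y ≤ a 0 * g y +
      ∑' n, (G n)ᶜ.indicator (fun _ => a (n + 1) * b) y := by
    classical
    filter_upwards [hae] with y hy
    -- if the first event that contains `y` is not `G 0`, then `y` lies outside the preceding one
    rcases hn : Nat.find hy with _ | n
    · have : y ∈ G 0 := by simpa [hn] using Nat.find_spec hy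
      exact (hf 0 y this).trans le_self_add
    · have h1 : y ∈ G (n + 1) := by simpa [hn] using Nat.find_spec hy
      have h2 : y ∈ (G n)ᶜ := Nat.find_min hy (by omega)
      calc f y ≤ a (n + 1) * g y := hf _ y h1
        _ ≤ a (n + 1) * b := by gcongr; exact hg y
        _ = (G n)ᶜ.indicator (fun _ => a (n + 1) * b) y := by rw [Set.indicator_of_mem h2]
        _ ≤ ∑' n, (G n)ᶜ.indicator (fun _ => a (n + 1) * b) y := ENNReal.le_tsum n
        _ ≤ _ := le_add_self
  have hm : ∀ n, Measurable ((G n)ᶜ.indicator (fun _ => a (n + 1) * b)) := fun n =>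
    measurable_const.indicator (hG n).compl
  refine (lintegral_mono_ae hpt).trans ?_
  rw [lintegral_add_right _ (Measurable.tsum hm), lintegral_const_mul' _ _ ha,
    lintegral_tsum fun n => (hm n).aemeasurable]
  gcongr with n
  rw [lintegral_indicator_const (hG n).compl]
  gcongr
  exact hp n

lemma add_two_sq_mul_exp_le (n : ℕ) : ((n : ℝ) + 2) ^ 2 * exp (-2 * n) ≤ 4 * (1 / 2) ^ n := by
  have h1 : ((n : ℝ) + 2) ^ 2 ≤ 4 * exp n := by
    have h := add_one_le_exp ((n : ℝ) / 2)
    have h2 : exp (n : ℝ) = exp ((n : ℝ) / 2) ^ 2 := by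
      rw [sq, ← exp_add]; congr 1; ring
    have h3 : ((n : ℝ) / 2 + 1) ^ 2 ≤ exp ((n : ℝ) / 2) ^ 2 := by gcongr
    rw [h2]
    linarith [h3]
  have h2 : exp (-(n : ℝ)) ≤ (1 / 2) ^ n := by
    have : exp (-(n : ℝ)) = (exp (-1)) ^ n := by rw [← exp_nat_mul]; congr 1; ring
    rw [this]
    gcongr
    rw [exp_neg, ← one_div]
    gcongr
    linarith [add_one_le_exp (1 : ℝ)]
  calc _ ≤ 4 * exp n * exp (-2 * n) := by gcongr
    _ = 4 * exp (-(n : ℝ)) := by rw [mul_assoc, ← exp_add]; congr 2; ring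
    _ ≤ _ := by gcongr

lemma noiseMoment_inner_le {Θ : Measure ℝ} [IsProbabilityMeasure pX] [IsProbabilityMeasure Θ]
    {σT σ0 τ : ℝ} (hT : 0 < σT) (hΘ : Θ (Set.Icc σT σ0)ᶜ = 0) (hτ : τ ∈ Set.Icc σT σ0) (y : E d) :
    ∫⁻ σ, ENNReal.ofReal (|1 - τ ^ 2 / σ ^ 2| ^ 2 + |log (τ / σ)| ^ 2) ∂(noisePosterior pX Θ y) ≤
      ENNReal.ofReal (5 * (σ0 - σT) ^ 2 * σ0 ^ 2 / σT ^ 4) := by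
  have := isProbabilityMeasure_noisePosterior (pX := pX) hT hΘ y
  refine (lintegral_mono_ae (g := fun _ => ENNReal.ofReal
    (5 * (σ0 - σT) ^ 2 * σ0 ^ 2 / σT ^ 4)) ?_).trans (by simp)
  filter_upwards [ae_mem_Icc_noisePosterior (pX := pX) hΘ y] with σ hσ
  exact ENNReal.ofReal_le_ofReal (noise_integrand_le hT hσ hτ)

lemma noiseMoment_le [IsProbabilityMeasure pX] {Θ : Measure ℝ} [IsProbabilityMeasure Θ]
    {σT σ0 τ : ℝ} (hT : 0 < σT) (hΘ : Θ (Set.Icc σT σ0)ᶜ = 0) (hτ : τ ∈ Set.Icc σT σ0) :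
    noiseMoment pX Θ τ ≤ ENNReal.ofReal (5 * (σ0 - σT) ^ 2 * σ0 ^ 2 / σT ^ 4) :=
  (lintegral_mono fun y => noiseMoment_inner_le hT hΘ hτ y).trans (by simp)

/-- The integrated cross-covariance at a free confidence level `κ`: besides the noise moment there
is an error from the events of small probability, which decays exponentially in `κ`. -/
lemma crossCovError_le_of_level [IsProbabilityMeasure pX] {Θ : Measure ℝ} [IsProbabilityMeasure Θ]
    (hd : 0 < d) {R σT σ0 τ κ : ℝ} (hR0 : 0 ≤ R) (hR : pX.support ⊆ Metric.closedBall 0 R)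
    (hT : 0 < σT) (h0 : σT < σ0) (hΘ : Θ (Set.Icc σT σ0)ᶜ = 0) (hτ : τ ∈ Set.Icc σT σ0)
    (hκ : 1 ≤ κ) :
    crossCovError pX Θ τ ≤ ENNReal.ofReal (2 * (160 * R * κ) ^ 2) * (noiseMoment pX Θ τ +
      8 * ENNReal.ofReal (5 * (σ0 - σT) ^ 2 * σ0 ^ 2 / σT ^ 4 *
        exp (-2 * (κ - intrinsicDim pX σT σ0)))) := by
  obtain ⟨hk1, G, hGm, hG⟩ := exists_good_events hd pX hR0 hR hT h0 hτ
  set k := intrinsicDim pX σT σ0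
  set b := 5 * (σ0 - σT) ^ 2 * σ0 ^ 2 / σT ^ 4
  have hb : 0 ≤ b := by positivity
  have hκn : ∀ n : ℕ, 1 ≤ κ + n := fun n => by
    have : (0 : ℝ) ≤ n := n.cast_nonneg
    linarith
  -- confidence level `κ + n` on the `n`-th event: the constants grow quadratically in `n`, the
  -- probabilities of the complements decay exponentially
  have main := lintegral_le_of_events (ν := noisyLaw pX τ)
    (f := fun y => ∫⁻ σ, ENNReal.ofReal (|∫ ω in σ..τ, ‖crossCov pX ω y‖ * (ω ^ 3)⁻¹| ^ 2)
      ∂(noisePosterior pX Θ y))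
    (g := fun y => ∫⁻ σ, ENNReal.ofReal (|1 - τ ^ 2 / σ ^ 2| ^ 2 + |log (τ / σ)| ^ 2)
      ∂(noisePosterior pX Θ y))
    (G := fun n => G (κ + n)) (a := fun n => ENNReal.ofReal (2 * (160 * R * (κ + n)) ^ 2))
    (p := fun n => ENNReal.ofReal (exp (-2 * (κ - k)) * exp (-2 * n)))
    (b := ENNReal.ofReal b) (fun n => hGm _) ?_ ?_ ENNReal.ofReal_ne_top ?_
    (noiseMoment_inner_le hT hΘ hτ)
  · refine main.trans ?_
    rw [Nat.cast_zero, add_zero, mul_add (ENNReal.ofReal _)]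
    refine add_le_add le_rfl ?_
    calc _ ≤ ∑' n : ℕ, ENNReal.ofReal (2 * (160 * R * κ) ^ 2) *
          ENNReal.ofReal (b * exp (-2 * (κ - k))) * (4 * (2⁻¹) ^ n) := by
          refine ENNReal.tsum_le_tsum fun n => ?_
          have h4 : (4 * (2⁻¹) ^ n : ENNReal) = ENNReal.ofReal (4 * (1 / 2) ^ n) := by
            rw [ENNReal.ofReal_mul (by norm_num), ENNReal.ofReal_pow (by norm_num), one_div,
              ENNReal.ofReal_inv_of_pos (by norm_num)]
            norm_num
          rw [h4, ← ENNReal.ofReal_mul (by positivity), ← ENNReal.ofReal_mul (by positivity),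
            ← ENNReal.ofReal_mul (by positivity), ← ENNReal.ofReal_mul (by positivity)]
          refine ENNReal.ofReal_le_ofReal ?_
          have h5 : κ + ((n + 1 : ℕ) : ℝ) ≤ κ * (n + 2) := by
            push_cast
            nlinarith [(n.cast_nonneg : (0 : ℝ) ≤ n)]
          calc 2 * (160 * R * (κ + ((n + 1 : ℕ) : ℝ))) ^ 2 * b *
                (exp (-2 * (κ - k)) * exp (-2 * n))
              ≤ 2 * (160 * R * (κ * (n + 2))) ^ 2 * b *
                (exp (-2 * (κ - k)) * exp (-2 * n)) := by gcongr
            _ = 2 * (160 * R * κ) ^ 2 * (b * exp (-2 * (κ - k))) *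
                (((n : ℝ) + 2) ^ 2 * exp (-2 * n)) := by ring
            _ ≤ _ := mul_le_mul_of_nonneg_left (add_two_sq_mul_exp_le n) (by positivity)
      _ = _ := by
          rw [ENNReal.tsum_mul_left, ENNReal.tsum_mul_left, ENNReal.tsum_geometric,
            ENNReal.one_sub_inv_two, inv_inv, mul_assoc]
          congr 1
          rw [mul_comm]
          congr 1
          norm_num
  · intro n
    refine ((hG (κ + n) (hκn n)).1).trans (ENNReal.ofReal_le_ofReal ?_)
    rw [← exp_add]
    have e : -2 * (κ + n - k) = -2 * (κ - k) + -2 * n := by ring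
    rw [e]
    linarith [exp_pos (-2 * (κ - k) + -2 * n)]
  · rw [← ENNReal.ofReal_zero]
    refine (ENNReal.continuous_ofReal.tendsto 0).comp ?_
    rw [← mul_zero (exp (-2 * (κ - k)))]
    refine Filter.Tendsto.const_mul _ (tendsto_exp_atBot.comp ?_)
    exact tendsto_natCast_atTop_atTop.const_mul_atTop_of_neg (by norm_num)
  · intro n y hy
    rw [← lintegral_const_mul' _ _ ENNReal.ofReal_ne_top]
    refine lintegral_mono_ae ?_
    filter_upwards [ae_mem_Icc_noisePosterior (pX := pX) hΘ y] with σ hσ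
    rw [← ENNReal.ofReal_mul (by positivity)]
    exact ENNReal.ofReal_le_ofReal (sq_integral_crossCov_le (hT.trans_le hσ.1)
      (hT.trans_le hτ.1) fun ω hω => ((hG (κ + n) (hκn n)).2 y hy ω hω).1)

/-- A confidence level at which the exponentially small error is dominated by the noise moment
turns the bound into a multiple of the noise moment. -/
lemma crossCovError_le_of_dominated [IsProbabilityMeasure pX] {Θ : Measure ℝ}
    [IsProbabilityMeasure Θ] (hd : 0 < d) {R σT σ0 τ κ : ℝ} (hR0 : 0 ≤ R)
    (hR : pX.support ⊆ Metric.closedBall 0 R)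
    (hT : 0 < σT) (h0 : σT < σ0) (hΘ : Θ (Set.Icc σT σ0)ᶜ = 0) (hτ : τ ∈ Set.Icc σT σ0)
    (hκ : 1 ≤ κ) (hM : ENNReal.ofReal (5 * (σ0 - σT) ^ 2 * σ0 ^ 2 / σT ^ 4 *
        exp (-2 * (κ - intrinsicDim pX σT σ0))) ≤ noiseMoment pX Θ τ) :
    crossCovError pX Θ τ ≤ ENNReal.ofReal (460800 * R ^ 2 * κ ^ 2) * noiseMoment pX Θ τ := by
  refine (crossCovError_le_of_level hd hR0 hR hT h0 hΘ hτ hκ).trans ?_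
  have e : (460800 * R ^ 2 * κ ^ 2 : ℝ) = 2 * (160 * R * κ) ^ 2 * 9 := by ring
  rw [e, ENNReal.ofReal_mul (p := 2 * (160 * R * κ) ^ 2) (by positivity),
    mul_assoc (ENNReal.ofReal _)]
  gcongr ENNReal.ofReal _ * ?_
  calc _ ≤ noiseMoment pX Θ τ + 8 * noiseMoment pX Θ τ := by gcongr
    _ = ENNReal.ofReal 9 * noiseMoment pX Θ τ := by
      rw [ENNReal.ofReal_ofNat]; ring

end

/-! ### Power law priors: regularity of the posterior density -/

section

section Slab

/-- If a density on `[a, b]` varies by at most a factor `2` over distances up to `2 s`, with `s`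
small compared with `b - a`, then a fixed part of its mass lies at distance at least `s` from a
given point `p`: the part near `p`, translated by `2 s` towards the farther endpoint, falls into the
rest. -/
lemma setLIntegral_Icc_le_three_mul {a b p s : ℝ} {g : ℝ → ENNReal} (hs : 0 < s)
    (hsab : 8 * s ≤ b - a) (hp : p ∈ Set.Icc a b)
    (hg : ∀ σ ∈ Set.Icc a b, ∀ σ' ∈ Set.Icc a b, |σ - σ'| ≤ 2 * s → g σ ≤ 2 * g σ') :
    ∫⁻ σ in Set.Icc a b, g σ ≤ 3 * ∫⁻ σ in Set.Icc a b ∩ {σ | s ≤ |σ - p|}, g σ := by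
  set O : Set ℝ := Set.Icc a b ∩ {σ | s ≤ |σ - p|} with hO
  set I : Set ℝ := Set.Icc a b ∩ {σ | |σ - p| < s} with hI
  have hIm : MeasurableSet I :=
    measurableSet_Icc.inter (measurableSet_lt (by fun_prop) (by fun_prop))
  have hunion : Set.Icc a b = I ∪ O := by
    rw [hI, hO, ← Set.inter_union_distrib_left]
    ext σ
    simp [lt_or_ge]
  have key : ∀ t : ℝ, |t| ≤ 2 * s → (∀ σ ∈ I, σ + t ∈ O) →
      ∫⁻ σ in I, g σ ≤ 2 * ∫⁻ σ in O, g σ := by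
    intro t ht htrans
    calc ∫⁻ σ in I, g σ ≤ ∫⁻ σ in I, 2 * g (σ + t) := by
          refine setLIntegral_mono' hIm fun σ hσ => ?_
          refine hg σ hσ.1 _ (htrans σ hσ).1 ?_
          rwa [sub_add_cancel_left, abs_neg]
      _ = 2 * ∫⁻ σ in I, g (σ + t) := lintegral_const_mul' _ _ (by norm_num)
      _ ≤ 2 * ∫⁻ σ in (fun σ => σ + t) ⁻¹' O, g (σ + t) := by
          gcongr
          exact htrans
      _ = 2 * ∫⁻ σ in O, g σ := by
          rw [(measurePreserving_add_right volume t).setLIntegral_comp_preimage_emb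
            (measurableEmbedding_addRight t)]
  have hIle : ∫⁻ σ in I, g σ ≤ 2 * ∫⁻ σ in O, g σ := by
    obtain ⟨hpa, hpb⟩ := hp
    rcases le_total (p - a) (b - p) with h | h
    · refine key (2 * s) (abs_of_pos (by positivity)).le fun σ hσ => ?_
      obtain ⟨⟨h1, h2⟩, h3⟩ := hσ
      have h4 := abs_lt.1 (show |σ - p| < s from h3)
      refine ⟨⟨by linarith, by linarith⟩, ?_⟩
      change s ≤ |σ + 2 * s - p|
      exact le_trans (b := σ + 2 * s - p) (by linarith) (le_abs_self _)
    · refine key (-(2 * s)) (by rw [abs_neg, abs_of_pos (by positivity)]) fun σ hσ => ?_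
      obtain ⟨⟨h1, h2⟩, h3⟩ := hσ
      have h4 := abs_lt.1 (show |σ - p| < s from h3)
      refine ⟨⟨by linarith, by linarith⟩, ?_⟩
      change s ≤ |σ + -(2 * s) - p|
      exact le_trans (b := -(σ + -(2 * s) - p)) (by linarith) (neg_le_abs _)
  calc ∫⁻ σ in Set.Icc a b, g σ ≤ (∫⁻ σ in I, g σ) + ∫⁻ σ in O, g σ := by
        rw [hunion]
        exact lintegral_union_le _ _ _
    _ ≤ 2 * (∫⁻ σ in O, g σ) + ∫⁻ σ in O, g σ := by gcongr
    _ = _ := by ring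

end Slab

variable {d : ℕ} {pX : Measure (E d)}

lemma rpow_le_exp_mul_rpow {c σ σ' : ℝ} (hc : 0 < c) (hσ : c ≤ σ) (hσ' : c ≤ σ') (β : ℝ) :
    σ ^ β ≤ exp (|β| * (|σ - σ'| / c)) * σ' ^ β := by
  have h1 : 0 < σ := hc.trans_le hσ
  have h2 : 0 < σ' := hc.trans_le hσ'
  rw [rpow_def_of_pos h1, rpow_def_of_pos h2, ← exp_add, exp_le_exp]
  have h3 := abs_log_div_le hc hσ' hσ
  rw [log_div h1.ne' h2.ne'] at h3
  have h4 : β * (log σ - log σ') ≤ |β| * (|σ - σ'| / c) := by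
    refine (le_abs_self _).trans ?_
    rw [abs_mul]
    gcongr
  linarith

lemma gaussian_prefactor_eq (d : ℕ) {σ : ℝ} (hσ : 0 < σ) :
    ((2 * π * σ ^ 2) ^ ((d : ℝ) / 2))⁻¹ = ((2 * π) ^ ((d : ℝ) / 2))⁻¹ * σ ^ (-(d : ℝ)) := by
  rw [mul_rpow (by positivity) (by positivity), mul_inv, ← rpow_natCast σ 2, ← rpow_mul hσ.le,
    rpow_neg hσ.le]
  congr 3
  push_cast
  ring

variable [IsProbabilityMeasure pX]

/-- Jensen's inequality bounds the loss of the Gaussian partition function when the noise level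
decreases from `σ` to `σ'` by the mean energy at the level `σ`. -/
lemma integral_exp_le_exp_mul {R : ℝ} (hR : ∀ᵐ x ∂pX, ‖x‖ ≤ R) (y : E d) {σ σ' t : ℝ}
    (ht : 1 / (2 * σ' ^ 2) - 1 / (2 * σ ^ 2) = t) (ht0 : 0 ≤ t) :
    ∫ x, exp (-‖x - y‖ ^ 2 / (2 * σ ^ 2)) ∂pX ≤
      exp (t * ∫ x, ‖x - y‖ ^ 2 ∂(posterior pX σ y)) *
        ∫ x, exp (-‖x - y‖ ^ 2 / (2 * σ' ^ 2)) ∂pX := by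
  set Z := ∫ x, exp (-‖x - y‖ ^ 2 / (2 * σ ^ 2)) ∂pX with hZ
  have hZ0 : 0 < Z := integral_exp_neg_norm_sq_pos σ y
  set m := ∫ x, ‖x - y‖ ^ 2 ∂(posterior pX σ y) with hm
  have hI := integrable_norm_sq_sub_posterior hR σ y
  have hexp : Integrable (fun x => exp (-(t * ‖x - y‖ ^ 2))) (posterior pX σ y) := by
    refine Integrable.of_bound (by fun_prop) 1 (Filter.Eventually.of_forall fun x => ?_)
    rw [norm_of_nonneg (exp_pos _).le, exp_le_one_iff]
    exact neg_nonpos.2 (by positivity)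
  have e : ∫ x, exp (-‖x - y‖ ^ 2 / (2 * σ' ^ 2)) ∂pX =
      Z * ∫ x, exp (-(t * ‖x - y‖ ^ 2)) ∂(posterior pX σ y) := by
    rw [posterior_integral, ← hZ, smul_eq_mul, mul_inv_cancel_left₀ hZ0.ne']
    congr 1
    ext x
    rw [smul_eq_mul, ← exp_add, ← ht]
    congr 1
    ring
  have hJ : exp (-(t * m)) ≤ ∫ x, exp (-(t * ‖x - y‖ ^ 2)) ∂(posterior pX σ y) := by
    have h1 : ∫ x, -(t * ‖x - y‖ ^ 2) ∂(posterior pX σ y) = -(t * m) := by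
      rw [integral_neg, integral_const_mul]
    rw [← h1]
    exact convexOn_exp.map_integral_le continuous_exp.continuousOn isClosed_univ
      (by simp) (hI.const_mul t).neg hexp
  rw [e]
  calc Z = exp (t * m) * (Z * exp (-(t * m))) := by
        rw [mul_left_comm, ← exp_add, add_neg_cancel, exp_zero, mul_one]
    _ ≤ _ := by gcongr

/-- A bound on the posterior energy makes `log p_σ(y)` Lipschitz in the noise level `σ`. -/
lemma noisyDensity_le_exp_mul {R : ℝ} (hR : ∀ᵐ x ∂pX, ‖x‖ ≤ R) {y : E d} {σT b : ℝ}
    (hT : 0 < σT) (hb : 0 ≤ b) {σ σ' : ℝ} (hσ : σT ≤ σ) (hσ' : σT ≤ σ')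
    (hE : ∫ x, ‖x - y‖ ^ 2 ∂(posterior pX σ y) ≤ b * σT ^ 2) :
    noisyDensity pX σ y ≤ exp ((d + b) * (|σ - σ'| / σT)) * noisyDensity pX σ' y := by
  have h0 : 0 < σ := hT.trans_le hσ
  have h0' : 0 < σ' := hT.trans_le hσ'
  have hpre := rpow_le_exp_mul_rpow hT hσ hσ' (-(d : ℝ))
  rw [abs_neg, Nat.abs_cast] at hpre
  have hZ : ∫ x, exp (-‖x - y‖ ^ 2 / (2 * σ ^ 2)) ∂pX ≤
      exp (b * (|σ - σ'| / σT)) * ∫ x, exp (-‖x - y‖ ^ 2 / (2 * σ' ^ 2)) ∂pX := by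
    -- the partition function increases with the noise level, so only a decrease costs anything
    rcases le_total σ σ' with h | h
    · refine (integral_mono (integrable_exp_neg_norm_sq σ y) (integrable_exp_neg_norm_sq σ' y)
        (fun x => ?_)).trans (le_mul_of_one_le_left (integral_exp_neg_norm_sq_pos σ' y).le
          (one_le_exp (by positivity)))
      change exp (-‖x - y‖ ^ 2 / (2 * σ ^ 2)) ≤ exp (-‖x - y‖ ^ 2 / (2 * σ' ^ 2))
      rw [exp_le_exp, neg_div, neg_div, neg_le_neg_iff]
      gcongr
    · set t := 1 / (2 * σ' ^ 2) - 1 / (2 * σ ^ 2) with ht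
      have ht0 : 0 ≤ t := by
        rw [ht, sub_nonneg]
        gcongr
      have hte : t = (σ - σ') * (σ + σ') / (2 * σ ^ 2 * σ' ^ 2) := by
        rw [ht]; field_simp; ring
      have htle : t ≤ (σ - σ') / σT ^ 3 := by
        rw [hte]
        have h1 : 0 ≤ σ - σ' := sub_nonneg.2 h
        calc (σ - σ') * (σ + σ') / (2 * σ ^ 2 * σ' ^ 2)
            ≤ (σ - σ') * (σ + σ) / (2 * σ ^ 2 * σ' ^ 2) := by gcongr
          _ = (σ - σ') / (σ * σ' ^ 2) := by field_simp; ring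
          _ ≤ (σ - σ') / (σT * σT ^ 2) := by gcongr
          _ = _ := by ring
      refine (integral_exp_le_exp_mul hR y ht.symm ht0).trans ?_
      have hexp : t * ∫ x, ‖x - y‖ ^ 2 ∂(posterior pX σ y) ≤ b * (|σ - σ'| / σT) := by
        calc t * ∫ x, ‖x - y‖ ^ 2 ∂(posterior pX σ y) ≤ t * (b * σT ^ 2) := by gcongr
          _ ≤ (σ - σ') / σT ^ 3 * (b * σT ^ 2) := by gcongr
          _ = b * (|σ - σ'| / σT) := by
            rw [abs_of_nonneg (sub_nonneg.2 h)]
            field_simp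
      have := (integral_exp_neg_norm_sq_pos (pX := pX) σ' y).le
      gcongr
  unfold noisyDensity
  rw [gaussian_prefactor_eq d h0, gaussian_prefactor_eq d h0', add_mul, exp_add]
  have hc : 0 ≤ ((2 * π) ^ ((d : ℝ) / 2))⁻¹ := by positivity
  have hZ0 := (integral_exp_neg_norm_sq_pos (pX := pX) σ y).le
  calc _ ≤ ((2 * π) ^ ((d : ℝ) / 2))⁻¹ * (exp (d * (|σ - σ'| / σT)) * σ' ^ (-(d : ℝ))) *
        (exp (b * (|σ - σ'| / σT)) * ∫ x, exp (-‖x - y‖ ^ 2 / (2 * σ' ^ 2)) ∂pX) := by gcongr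
    _ = _ := by ring

section PowerPrior

variable {σT σ0 : ℝ}

lemma powerPrior_mass (hT : 0 < σT) (h0 : σT < σ0) (α : ℝ) :
    ((volume.restrict (Set.Icc σT σ0)).withDensity
      (fun σ => ENNReal.ofReal (σ ^ (α - 3)))) Set.univ ≠ 0 ∧
    ((volume.restrict (Set.Icc σT σ0)).withDensity
      (fun σ => ENNReal.ofReal (σ ^ (α - 3)))) Set.univ ≠ ⊤ := by
  rw [withDensity_apply _ MeasurableSet.univ, Measure.restrict_univ]
  constructor
  · rw [Ne, lintegral_eq_zero_iff (by fun_prop)]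
    intro h
    have h1 : ∀ᵐ σ ∂(volume.restrict (Set.Icc σT σ0)), False := by
      filter_upwards [h, ae_restrict_mem measurableSet_Icc] with σ hσ hm
      have := rpow_pos_of_pos (hT.trans_le hm.1) (α - 3)
      simp only [Pi.zero_apply, ENNReal.ofReal_eq_zero] at hσ
      linarith
    rw [Filter.eventually_false_iff_eq_bot, ae_eq_bot, Measure.restrict_eq_zero, volume_Icc,
      ENNReal.ofReal_eq_zero] at h1
    linarith
  · have hc : ContinuousOn (fun σ : ℝ => σ ^ (α - 3)) (Set.Icc σT σ0) := fun σ hσ =>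
      (continuousAt_rpow_const _ _ (Or.inl (hT.trans_le hσ.1).ne')).continuousWithinAt
    exact (hc.integrableOn_compact isCompact_Icc).lintegral_lt_top.ne

lemma isProbabilityMeasure_powerPrior (hT : 0 < σT) (h0 : σT < σ0) (α : ℝ) :
    IsProbabilityMeasure (powerPrior σT σ0 α) :=
  isProbabilityMeasure_normalize (powerPrior_mass hT h0 α).1 (powerPrior_mass hT h0 α).2

lemma powerPrior_compl_Icc (α : ℝ) : powerPrior σT σ0 α (Set.Icc σT σ0)ᶜ = 0 := by
  rw [powerPrior, normalize, Measure.smul_apply, smul_eq_mul]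
  have : (volume.restrict (Set.Icc σT σ0)) (Set.Icc σT σ0)ᶜ = 0 := by
    rw [Measure.restrict_apply measurableSet_Icc.compl, Set.compl_inter_self, measure_empty]
  rw [(withDensity_absolutelyContinuous _ _) this, mul_zero]

/-- The posterior of the noise level under the power law prior integrates against the density
`σ ^ (α - 3) p_σ(y)`, up to normalization. -/
lemma le_lintegral_noisePosterior_powerPrior (hT : 0 < σT) (h0 : σT < σ0) (α : ℝ) (y : E d)
    {φ : ℝ → ENNReal} (hφ : Measurable φ) {c : ENNReal}
    (h : c * ∫⁻ σ in Set.Icc σT σ0, ENNReal.ofReal (σ ^ (α - 3) * noisyDensity pX σ y) ≤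
      ∫⁻ σ in Set.Icc σT σ0, ENNReal.ofReal (σ ^ (α - 3) * noisyDensity pX σ y) * φ σ) :
    c ≤ ∫⁻ σ, φ σ ∂(noisePosterior pX (powerPrior σT σ0 α) y) := by
  have hprob := isProbabilityMeasure_powerPrior hT h0 α
  have hpost := isProbabilityMeasure_noisePosterior (pX := pX) hT
    (powerPrior_compl_Icc (σT := σT) (σ0 := σ0) α) y
  have hmp := (measurable_noisyDensity (pX := pX) y).ennreal_ofReal
  have hform : ∃ a : ENNReal, noisePosterior pX (powerPrior σT σ0 α) y =
      a • (volume.restrict (Set.Icc σT σ0)).withDensity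
        (fun σ => ENNReal.ofReal (σ ^ (α - 3) * noisyDensity pX σ y)) := by
    have e := withDensity_mul (volume.restrict (Set.Icc σT σ0))
      (f := fun σ => ENNReal.ofReal (σ ^ (α - 3))) (by fun_prop) hmp
    have e2 : (volume.restrict (Set.Icc σT σ0)).withDensity
        ((fun σ => ENNReal.ofReal (σ ^ (α - 3))) * fun σ => ENNReal.ofReal (noisyDensity pX σ y)) =
        (volume.restrict (Set.Icc σT σ0)).withDensity
          (fun σ => ENNReal.ofReal (σ ^ (α - 3) * noisyDensity pX σ y)) := by
      refine withDensity_congr_ae ?_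
      filter_upwards [ae_restrict_mem measurableSet_Icc] with σ hσ
      rw [ENNReal.ofReal_mul (rpow_nonneg (hT.le.trans hσ.1) _)]
      rfl
    rw [noisePosterior]
    unfold powerPrior
    unfold normalize
    rw [withDensity_smul_measure, smul_smul, ← e, e2]
    exact ⟨_, rfl⟩
  obtain ⟨a, ha⟩ := hform
  have hmg : Measurable (fun σ => ENNReal.ofReal (σ ^ (α - 3) * noisyDensity pX σ y)) :=
    ((Measurable.pow_const measurable_id _).mul (measurable_noisyDensity y)).ennreal_ofReal
  have h1 := hpost.measure_univ
  rw [ha, Measure.smul_apply, withDensity_apply _ MeasurableSet.univ, Measure.restrict_univ,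
    smul_eq_mul] at h1
  rw [ha, lintegral_smul_measure, lintegral_withDensity_eq_lintegral_mul _ hmg hφ, smul_eq_mul]
  calc c = c * (a * ∫⁻ σ in Set.Icc σT σ0, ENNReal.ofReal (σ ^ (α - 3) * noisyDensity pX σ y)) := by
        rw [h1, mul_one]
    _ = a * (c * ∫⁻ σ in Set.Icc σT σ0, ENNReal.ofReal (σ ^ (α - 3) * noisyDensity pX σ y)) := by
        ring
    _ ≤ _ := by
        gcongr
        exact h

end PowerPrior

end

/-! ### Choice of the confidence level -/

section

variable {d : ℕ} {pX : Measure (E d)} [IsProbabilityMeasure pX] {R σT σ0 τ : ℝ}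

/-- For a power law prior the noise moment cannot be small: on an event of probability at least
`1 / 2` the logarithm of the posterior density of the noise level has Lipschitz constant at most
`l / σT`, so that the posterior spreads over a distance of order at least
`(σ0 - σT) σT / (l σ0)`. -/
lemma le_noiseMoment_powerPrior (hd : 0 < d) (hR0 : 0 ≤ R)
    (hR : pX.support ⊆ Metric.closedBall 0 R) (hT : 0 < σT) (h0 : σT < σ0)
    (hτ : τ ∈ Set.Icc σT σ0) (α : ℝ) {l : ℝ}
    (hl : |α - 3| + (d + 144 * (σ0 / σT) ^ 2 * (d + intrinsicDim pX σT σ0)) ≤ l) :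
    ENNReal.ofReal (((σ0 - σT) * σT / (8 * l * σ0)) ^ 2 / (6 * σ0 ^ 2)) ≤
      noiseMoment pX (powerPrior σT σ0 α) τ := by
  obtain ⟨hk1, G, hGm, hG⟩ := exists_good_events hd pX hR0 hR hT h0 hτ
  set k := intrinsicDim pX σT σ0
  have hRae := ae_norm_le_of_support hR
  have hσ0 : 0 < σ0 := hT.trans h0
  have hd1 : (1 : ℝ) ≤ d := by exact_mod_cast hd
  set b := 144 * (σ0 / σT) ^ 2 * (d + k) with hb
  have hb0 : 0 ≤ b := by positivity
  have hl1 : 1 ≤ l := by linarith [abs_nonneg (α - 3)]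
  have hD : 0 < σ0 - σT := sub_pos.2 h0
  set s := (σ0 - σT) * σT / (8 * l * σ0) with hs
  have hs0 : 0 < s := by positivity
  have hs1 : 8 * s ≤ σ0 - σT := by
    have e : 8 * s = (σ0 - σT) * (σT / (l * σ0)) := by rw [hs]; field_simp
    rw [e]
    refine mul_le_of_le_one_right hD.le ?_
    rw [div_le_one (by positivity)]
    nlinarith
  -- over distances up to `2 s` the posterior density varies at most by a factor `2`
  have hs2 : l * (2 * s / σT) ≤ log 2 := by
    have e : l * (2 * s / σT) = (σ0 - σT) / σ0 / 4 := by rw [hs]; field_simp; norm_num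
    have h1 : (σ0 - σT) / σ0 ≤ 1 := by rw [div_le_one hσ0]; linarith
    linarith [log_two_gt_d9]
  have hinner : ∀ y ∈ G k, ENNReal.ofReal (s ^ 2 / (3 * σ0 ^ 2)) ≤
      ∫⁻ σ, ENNReal.ofReal (|1 - τ ^ 2 / σ ^ 2| ^ 2 + |log (τ / σ)| ^ 2)
        ∂(noisePosterior pX (powerPrior σT σ0 α) y) := by
    intro y hy
    refine le_lintegral_noisePosterior_powerPrior hT h0 α y (by fun_prop) ?_
    have hg : ∀ σ ∈ Set.Icc σT σ0, ∀ σ' ∈ Set.Icc σT σ0, |σ - σ'| ≤ 2 * s →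
        ENNReal.ofReal (σ ^ (α - 3) * noisyDensity pX σ y) ≤
          2 * ENNReal.ofReal (σ' ^ (α - 3) * noisyDensity pX σ' y) := by
      intro σ hσ σ' hσ' hdist
      have hσp : 0 < σ := hT.trans_le hσ.1
      have hσp' : 0 < σ' := hT.trans_le hσ'.1
      have hE : ∫ x, ‖x - y‖ ^ 2 ∂(posterior pX σ y) ≤ b * σT ^ 2 := by
        refine ((hG k hk1).2 y hy σ hσp).2.trans ?_
        have e : b * σT ^ 2 = 72 * ((σ0 ^ 2 + σ0 ^ 2) * (d + k)) := by
          rw [hb]; field_simp; ring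
        rw [e]
        have := hτ.2
        have := hσ.2
        have := hT.trans_le hτ.1
        gcongr
      have h1 := rpow_le_exp_mul_rpow hT hσ.1 hσ'.1 (α - 3)
      have h2 := noisyDensity_le_exp_mul hRae hT hb0 hσ.1 hσ'.1 hE
      have h3 := (noisyDensity_pos (pX := pX) hσp y).le
      have h4 := (noisyDensity_pos (pX := pX) hσp' y).le
      rw [← ENNReal.ofReal_ofNat 2, ← ENNReal.ofReal_mul (by norm_num)]
      refine ENNReal.ofReal_le_ofReal ?_
      calc σ ^ (α - 3) * noisyDensity pX σ y
          ≤ (exp (|α - 3| * (|σ - σ'| / σT)) * σ' ^ (α - 3)) *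
            (exp ((d + b) * (|σ - σ'| / σT)) * noisyDensity pX σ' y) := by gcongr
        _ = exp ((|α - 3| + (d + b)) * (|σ - σ'| / σT)) *
            (σ' ^ (α - 3) * noisyDensity pX σ' y) := by
          rw [add_mul |α - 3|, exp_add]; ring
        _ ≤ exp (l * (2 * s / σT)) * (σ' ^ (α - 3) * noisyDensity pX σ' y) := by gcongr
        _ ≤ 2 * (σ' ^ (α - 3) * noisyDensity pX σ' y) := by
          gcongr
          rwa [← le_log_iff_exp_le (by norm_num)]
    have hslab := setLIntegral_Icc_le_three_mul hs0 hs1 hτ hg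
    set O : Set ℝ := Set.Icc σT σ0 ∩ {σ | s ≤ |σ - τ|} with hO
    have hOm : MeasurableSet O :=
      measurableSet_Icc.inter (measurableSet_le (by fun_prop) (by fun_prop))
    have hφ : ∀ σ ∈ O, ENNReal.ofReal (s ^ 2 / σ0 ^ 2) ≤
        ENNReal.ofReal (|1 - τ ^ 2 / σ ^ 2| ^ 2 + |log (τ / σ)| ^ 2) := by
      rintro σ ⟨hσ, hσs⟩
      have h1 := le_abs_log_div (hT.trans_le hσ.1) hσ.2 (hT.trans_le hτ.1) hτ.2
      have h2 : s / σ0 ≤ |log (τ / σ)| := by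
        refine le_trans ?_ h1
        rw [abs_sub_comm]
        have : s ≤ |σ - τ| := hσs
        gcongr
      refine ENNReal.ofReal_le_ofReal ?_
      rw [← div_pow]
      have h3 : (s / σ0) ^ 2 ≤ |log (τ / σ)| ^ 2 := by gcongr
      linarith [sq_nonneg |1 - τ ^ 2 / σ ^ 2|]
    have e : ENNReal.ofReal (s ^ 2 / (3 * σ0 ^ 2)) * 3 = ENNReal.ofReal (s ^ 2 / σ0 ^ 2) := by
      rw [← ENNReal.ofReal_ofNat 3, ← ENNReal.ofReal_mul (by positivity)]
      congr 1
      field_simp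
    calc _ ≤ ENNReal.ofReal (s ^ 2 / (3 * σ0 ^ 2)) *
          (3 * ∫⁻ σ in O, ENNReal.ofReal (σ ^ (α - 3) * noisyDensity pX σ y)) := by gcongr
      _ = ∫⁻ σ in O, ENNReal.ofReal (σ ^ (α - 3) * noisyDensity pX σ y) *
          ENNReal.ofReal (s ^ 2 / σ0 ^ 2) := by
        rw [← mul_assoc, e, lintegral_mul_const' _ _ ENNReal.ofReal_ne_top, mul_comm]
      _ ≤ ∫⁻ σ in O, ENNReal.ofReal (σ ^ (α - 3) * noisyDensity pX σ y) *
          ENNReal.ofReal (|1 - τ ^ 2 / σ ^ 2| ^ 2 + |log (τ / σ)| ^ 2) := by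
        refine setLIntegral_mono' hOm fun σ hσ => ?_
        gcongr ENNReal.ofReal _ * ?_
        exact hφ σ hσ
      _ ≤ _ := lintegral_mono_set Set.inter_subset_left
  have hprob : ENNReal.ofReal (1 / 2) ≤ noisyLaw pX τ (G k) := by
    have h1 := (hG k hk1).1
    rw [sub_self, mul_zero, exp_zero] at h1
    have h2 := prob_add_prob_compl (μ := noisyLaw pX τ) (hGm k)
    have h3 : (1 : ENNReal) ≤ noisyLaw pX τ (G k) + ENNReal.ofReal (1 / 2) := by
      rw [← h2]; gcongr
    have h4 : (1 : ENNReal) = ENNReal.ofReal (1 / 2) + ENNReal.ofReal (1 / 2) := by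
      rw [← ENNReal.ofReal_add (by norm_num) (by norm_num)]; norm_num
    rw [h4] at h3
    exact (ENNReal.add_le_add_iff_right ENNReal.ofReal_ne_top).1 h3
  calc ENNReal.ofReal (s ^ 2 / (6 * σ0 ^ 2))
      = ENNReal.ofReal (s ^ 2 / (3 * σ0 ^ 2)) * ENNReal.ofReal (1 / 2) := by
        rw [← ENNReal.ofReal_mul (by positivity)]
        congr 1
        field_simp
        norm_num
    _ ≤ ENNReal.ofReal (s ^ 2 / (3 * σ0 ^ 2)) * noisyLaw pX τ (G k) := by gcongr
    _ = ∫⁻ _ in G k, ENNReal.ofReal (s ^ 2 / (3 * σ0 ^ 2)) ∂(noisyLaw pX τ) := by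
        rw [setLIntegral_const]
    _ ≤ ∫⁻ y in G k, ∫⁻ σ, ENNReal.ofReal (|1 - τ ^ 2 / σ ^ 2| ^ 2 + |log (τ / σ)| ^ 2)
        ∂(noisePosterior pX (powerPrior σT σ0 α) y) ∂(noisyLaw pX τ) :=
        setLIntegral_mono' (hGm k) hinner
    _ ≤ _ := setLIntegral_le_lintegral _ _

/-- If the noise moment vanishes, so does the integrated cross-covariance: let the confidence level
tend to infinity. -/
lemma crossCovError_eq_zero {Θ : Measure ℝ} [IsProbabilityMeasure Θ] (hd : 0 < d) (hR0 : 0 ≤ R)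
    (hR : pX.support ⊆ Metric.closedBall 0 R) (hT : 0 < σT) (h0 : σT < σ0)
    (hΘ : Θ (Set.Icc σT σ0)ᶜ = 0) (hτ : τ ∈ Set.Icc σT σ0) (hM : noiseMoment pX Θ τ = 0) :
    crossCovError pX Θ τ = 0 := by
  set k := intrinsicDim pX σT σ0
  set b := 5 * (σ0 - σT) ^ 2 * σ0 ^ 2 / σT ^ 4
  have hb : 0 ≤ b := by positivity
  set K := 2 * (160 * R) ^ 2 * (8 * (b * exp (2 * k))) with hK
  have hle : ∀ κ : ℝ, 1 ≤ κ → crossCovError pX Θ τ ≤ ENNReal.ofReal (K * (κ ^ 2 * exp (-κ))) := by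
    intro κ hκ
    refine (crossCovError_le_of_level hd hR0 hR hT h0 hΘ hτ hκ).trans ?_
    rw [hM, zero_add, ← ENNReal.ofReal_ofNat 8, ← ENNReal.ofReal_mul (by norm_num),
      ← ENNReal.ofReal_mul (by positivity)]
    refine ENNReal.ofReal_le_ofReal ?_
    have e : exp (-2 * (κ - k)) ≤ exp (2 * k) * exp (-κ) := by
      rw [← exp_add, exp_le_exp]; linarith
    calc _ ≤ 2 * (160 * R * κ) ^ 2 * (8 * (b * (exp (2 * k) * exp (-κ)))) := by gcongr
      _ = _ := by rw [hK]; ring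
  have hlim : Filter.Tendsto (fun κ : ℝ => ENNReal.ofReal (K * (κ ^ 2 * exp (-κ))))
      Filter.atTop (nhds 0) := by
    rw [← ENNReal.ofReal_zero, ← mul_zero K]
    exact (ENNReal.continuous_ofReal.tendsto _).comp
      ((tendsto_pow_mul_exp_neg_atTop_nhds_zero 2).const_mul K)
  refine le_antisymm (ge_of_tendsto hlim ?_) zero_le
  filter_upwards [Filter.eventually_ge_atTop 1] with κ hκ using hle κ hκ

/-- The level `k + 2 L` suffices because the noise moment `M` is bounded below by
`exp (-|log M|)`. -/
lemma crossCovError_le {Θ : Measure ℝ} [IsProbabilityMeasure Θ] (hd : 0 < d) (hR0 : 0 ≤ R)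
    (hR : pX.support ⊆ Metric.closedBall 0 R) (hT : 0 < σT) (h0 : σT < σ0)
    (hΘ : Θ (Set.Icc σT σ0)ᶜ = 0) (hτ : τ ∈ Set.Icc σT σ0) {L : ℝ}
    (hL : L = 1 + log (σ0 / σT) + |log (noiseMoment pX Θ τ).toReal|) :
    crossCovError pX Θ τ ≤
      ENNReal.ofReal (460800 * R ^ 2 * (intrinsicDim pX σT σ0 + 2 * L) ^ 2) *
        noiseMoment pX Θ τ := by
  have hk1 := (exists_good_events hd pX hR0 hR hT h0 hτ).1
  rcases eq_or_ne (noiseMoment pX Θ τ) 0 with hM | hM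
  · rw [crossCovError_eq_zero hd hR0 hR hT h0 hΘ hτ hM]
    exact zero_le
  have hMtop : noiseMoment pX Θ τ ≠ ⊤ :=
    ne_top_of_le_ne_top ENNReal.ofReal_ne_top (noiseMoment_le hT hΘ hτ)
  have hσ0 : 0 < σ0 := hT.trans h0
  set k := intrinsicDim pX σT σ0
  set M := (noiseMoment pX Θ τ).toReal with hMdef
  have hMpos : 0 < M := ENNReal.toReal_pos hM hMtop
  set ρ := σ0 / σT with hρ
  have hρ1 : 1 ≤ ρ := by rw [hρ, one_le_div hT]; exact h0.le
  have hlogρ : 0 ≤ log ρ := log_nonneg hρ1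
  have hL1 : 1 ≤ L := by rw [hL]; linarith [abs_nonneg (log M)]
  refine crossCovError_le_of_dominated hd hR0 hR hT h0 hΘ hτ (by linarith) ?_
  rw [← ENNReal.ofReal_toReal hMtop, ← hMdef]
  refine ENNReal.ofReal_le_ofReal ?_
  have h1 : 5 * (σ0 - σT) ^ 2 * σ0 ^ 2 / σT ^ 4 ≤ 5 * ρ ^ 4 := by
    have e : 5 * ρ ^ 4 = 5 * σ0 ^ 2 * σ0 ^ 2 / σT ^ 4 := by rw [hρ, div_pow]; ring
    rw [e]
    have : 0 ≤ σ0 - σT := (sub_pos.2 h0).le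
    gcongr
    linarith
  have h2 : exp (-2 * (k + 2 * L - k)) = exp (-4) * (ρ ^ 4)⁻¹ * exp (-4 * |log M|) := by
    have : (ρ ^ 4)⁻¹ = exp (-4 * log ρ) := by
      have h := exp_nat_mul (log ρ) 4
      rw [exp_log (by positivity)] at h
      rw [← h, ← exp_neg]
      congr 1
      push_cast
      ring
    rw [this, ← exp_add, ← exp_add, hL]
    congr 1
    ring
  have h3 : exp (-4 * |log M|) ≤ M := by
    rw [← le_log_iff_exp_le hMpos]
    have := neg_abs_le (log M)
    linarith [abs_nonneg (log M)]
  have h4 : 5 * exp (-4) ≤ 1 := by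
    rw [exp_neg, ← div_eq_mul_inv, div_le_one (exp_pos _)]
    linarith [add_one_le_exp (4 : ℝ)]
  rw [h2]
  calc _ ≤ 5 * ρ ^ 4 * (exp (-4) * (ρ ^ 4)⁻¹ * exp (-4 * |log M|)) := by gcongr
    _ = 5 * exp (-4) * exp (-4 * |log M|) := by field_simp
    _ ≤ 1 * M := by gcongr
    _ = M := one_mul M

/-- At confidence level `2 k + 12 L` the exponentially small error is dominated by the lower bound
for the noise moment under a power law prior. -/
lemma crossCovError_powerPrior_le (hd : 0 < d) (hR0 : 0 ≤ R)
    (hR : pX.support ⊆ Metric.closedBall 0 R) (hT : 0 < σT) (h0 : σT < σ0)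
    (hτ : τ ∈ Set.Icc σT σ0) (α : ℝ) {L : ℝ}
    (hL : L = 1 + log d + log (σ0 / σT) + log (1 + |α|)) :
    crossCovError pX (powerPrior σT σ0 α) τ ≤
      ENNReal.ofReal (460800 * R ^ 2 * (2 * intrinsicDim pX σT σ0 + 12 * L) ^ 2) *
        noiseMoment pX (powerPrior σT σ0 α) τ := by
  have hk1 := (exists_good_events hd pX hR0 hR hT h0 hτ).1
  have hσ0 : 0 < σ0 := hT.trans h0
  have hprob := isProbabilityMeasure_powerPrior hT h0 α
  set k := intrinsicDim pX σT σ0 with hk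
  set ρ := σ0 / σT with hρ
  have hρ1 : 1 ≤ ρ := by rw [hρ, one_le_div hT]; exact h0.le
  have hd1 : (1 : ℝ) ≤ d := by exact_mod_cast hd
  set A := 1 + |α| with hA
  have hA1 : 1 ≤ A := by linarith [abs_nonneg α]
  have hL1 : 1 ≤ L := by
    rw [hL]; linarith [log_nonneg hd1, log_nonneg hρ1, log_nonneg hA1]
  refine crossCovError_le_of_dominated hd hR0 hR hT h0 (powerPrior_compl_Icc α) hτ (by linarith) ?_
  set l := 300 * A * ρ ^ 2 * d * k with hl
  have hlb : |α - 3| + (d + 144 * ρ ^ 2 * (d + k)) ≤ l := by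
    have h1 : |α - 3| ≤ 3 * A := by
      have := abs_sub α 3
      rw [abs_of_pos (by norm_num : (0 : ℝ) < 3)] at this
      linarith [abs_nonneg α]
    have hρ2 : 1 ≤ ρ ^ 2 := one_le_pow₀ hρ1
    have hdk : 1 ≤ d * k := one_le_mul_of_one_le_of_one_le hd1 hk1
    have hAρ : 1 ≤ A * ρ ^ 2 := one_le_mul_of_one_le_of_one_le hA1 hρ2
    have h2 : (d : ℝ) ≤ d * k := le_mul_of_one_le_right (by linarith) hk1
    have h3 : k ≤ d * k := le_mul_of_one_le_left (by linarith) hd1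
    have h4 : A ≤ A * ρ ^ 2 * (d * k) := by
      calc A = A * 1 * 1 := by ring
        _ ≤ _ := by gcongr
    have h5 : (d : ℝ) * k ≤ A * ρ ^ 2 * (d * k) := le_mul_of_one_le_left (by linarith) hAρ
    have h6 : ρ ^ 2 * (d + k) ≤ A * ρ ^ 2 * (d * k) * 2 := by
      calc ρ ^ 2 * (d + k) ≤ (A * ρ ^ 2) * (d * k + d * k) := by
            gcongr
            exact le_mul_of_one_le_left (by linarith) hA1
        _ = _ := by ring
    rw [hl]
    linarith
  refine le_trans (ENNReal.ofReal_le_ofReal ?_)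
    (le_noiseMoment_powerPrior hd hR0 hR hT h0 hτ α hlb)
  have hl0 : 0 < l := by positivity
  have hexp : 1920 * ρ ^ 6 * l ^ 2 ≤ exp (2 * (2 * k + 12 * L - k)) := by
    set X := d * ρ * A with hX
    have hX1 : 1 ≤ X :=
      one_le_mul_of_one_le_of_one_le (one_le_mul_of_one_le_of_one_le hd1 hρ1) hA1
    -- `exp L` dominates every parameter polynomially, and `exp k` dominates `k`
    have e1 : exp L = exp 1 * X := by
      rw [hL, exp_add, exp_add, exp_add, exp_log (by linarith), exp_log (by linarith),
        exp_log (by linarith), hX]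
      ring
    have e2 : exp (2 * (2 * k + 12 * L - k)) = exp k ^ 2 * (exp 2 ^ 12 * X ^ 24) := by
      have : exp 2 ^ 12 * X ^ 24 = exp L ^ 24 := by
        rw [e1, mul_pow (exp 1), ← exp_nat_mul, ← exp_nat_mul]
        congr 2
        norm_num
      rw [this, ← exp_nat_mul, ← exp_nat_mul, ← exp_add]
      congr 1
      push_cast
      ring
    have h1 : ρ ^ 3 * l ≤ 300 * X ^ 5 * k := by
      have h2 : A * ρ ^ 5 * d ≤ X ^ 5 := by
        rw [hX, mul_pow, mul_pow]
        have ha : A ≤ A ^ 5 := le_self_pow₀ hA1 (by norm_num)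
        have hdd : (d : ℝ) ≤ (d : ℝ) ^ 5 := le_self_pow₀ hd1 (by norm_num)
        calc A * ρ ^ 5 * d ≤ A ^ 5 * ρ ^ 5 * (d : ℝ) ^ 5 := by gcongr
          _ = _ := by ring
      calc ρ ^ 3 * l = 300 * (A * ρ ^ 5 * d) * k := by rw [hl]; ring
        _ ≤ _ := by gcongr
    have h3 : k ≤ exp k := by linarith [add_one_le_exp k]
    rw [e2]
    calc 1920 * ρ ^ 6 * l ^ 2 = 1920 * (ρ ^ 3 * l) ^ 2 := by ring
      _ ≤ 1920 * (300 * X ^ 5 * k) ^ 2 := by gcongr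
      _ = k ^ 2 * (172800000 * X ^ 10) := by ring
      _ ≤ exp k ^ 2 * (6 ^ 12 * X ^ 24) := by
        gcongr
        · norm_num
        · norm_num
      _ ≤ _ := by
        gcongr
        exact six_le_exp_two
  have e : exp (-2 * (2 * k + 12 * L - k)) = (exp (2 * (2 * k + 12 * L - k)))⁻¹ := by
    rw [← exp_neg]; congr 1; ring
  rw [e]
  calc _ ≤ 5 * (σ0 - σT) ^ 2 * σ0 ^ 2 / σT ^ 4 * (1920 * ρ ^ 6 * l ^ 2)⁻¹ := by gcongr
    _ = _ := by
      rw [hρ]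
      field_simp
      ring

end

end BlindDenoising

theorem mainTheorem9 :
    ∃ C : ℝ, 0 < C ∧
      ∀ (d : ℕ) (_ : 0 < d) (pX : Measure (BlindDenoising.E d)) (_ : IsProbabilityMeasure pX)
        (R σT σ0 τ : ℝ) (_ : 0 < R) (_ : pX.support ⊆ Metric.closedBall 0 R)
        (_ : 0 < σT) (_ : σT < σ0) (_ : τ ∈ Set.Icc σT σ0)
        (k : ℝ) (_ : k = BlindDenoising.intrinsicDim pX σT σ0),
        -- high-probability bound on the conditional cross-covariance
        (∀ δ : ℝ, 0 < δ → δ < 1 →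
          BlindDenoising.noisyLaw pX τ
            {y | ¬ ∀ ω : ℝ, σT ≤ ω →
              ‖BlindDenoising.crossCov pX ω y‖ ≤
                C * (τ ^ 2 + ω ^ 2) * (R + Real.sqrt (k + Real.log (1 / δ))) *
                  (k + Real.log (1 / δ))} ≤ ENNReal.ofReal δ) ∧
        -- integrated bound, for an arbitrary prior on the noise level
        (∀ (Θ : Measure ℝ) (_ : IsProbabilityMeasure Θ) (_ : Θ (Set.Icc σT σ0)ᶜ = 0),
          BlindDenoising.mismatchError pX Θ τ ≤ BlindDenoising.crossCovError pX Θ τ ∧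
          BlindDenoising.crossCovError pX Θ τ ≤
            ENNReal.ofReal (C * ((R ^ 2 + k) * k ^ 2) *
              (1 + Real.log (σ0 / σT) +
                |Real.log (BlindDenoising.noiseMoment pX Θ τ).toReal|) ^ 3) *
              BlindDenoising.noiseMoment pX Θ τ) ∧
        -- integrated bound for power law priors, with explicit logarithmic factors
        (∀ α : ℝ,
          BlindDenoising.crossCovError pX (BlindDenoising.powerPrior σT σ0 α) τ ≤
            ENNReal.ofReal (C * ((R ^ 2 + k) * k ^ 2) *
              (1 + Real.log d + Real.log (σ0 / σT) + Real.log (1 + |α|)) ^ 3) *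
              BlindDenoising.noiseMoment pX (BlindDenoising.powerPrior σT σ0 α) τ) := by
  refine ⟨10 ^ 8, by norm_num, ?_⟩
  intro d hd pX hpX R σT σ0 τ hR0 hR hT h0 hτ k hk
  obtain ⟨hk1, G, hGm, hG⟩ := BlindDenoising.exists_good_events hd pX hR0.le hR hT h0 hτ
  have hρ1 : 1 ≤ σ0 / σT := by rw [one_le_div hT]; exact h0.le
  have hlogρ := Real.log_nonneg hρ1
  rw [← hk] at hk1
  -- a level of order `k L` is absorbed by the factor `k ^ 2 * L ^ 3`
  have hlevel : ∀ L κ : ℝ, 1 ≤ L → 0 ≤ κ → κ ≤ 14 * (k * L) →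
      460800 * R ^ 2 * κ ^ 2 ≤ 10 ^ 8 * ((R ^ 2 + k) * k ^ 2) * L ^ 3 := by
    intro L κ hL hκ0 hκ
    have hLL : L ^ 2 ≤ L ^ 3 := pow_le_pow_right₀ hL (by norm_num)
    calc 460800 * R ^ 2 * κ ^ 2 ≤ 460800 * R ^ 2 * (14 * (k * L)) ^ 2 := by gcongr
      _ = 90316800 * (R ^ 2 * k ^ 2) * L ^ 2 := by ring
      _ ≤ 10 ^ 8 * ((R ^ 2 + k) * k ^ 2) * L ^ 3 := by
        gcongr
        · norm_num
        · linarith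
  have hkL : ∀ L : ℝ, 1 ≤ L → k + L ≤ 2 * (k * L) := by
    intro L hL
    nlinarith
  refine ⟨fun δ hδ0 hδ1 => ?_, fun Θ hΘp hΘ => ⟨?_, ?_⟩, fun α => ?_⟩
  · set κ := k + Real.log (1 / δ) with hκ
    have hlogδ : 0 ≤ Real.log (1 / δ) := Real.log_nonneg (by rw [le_div_iff₀ hδ0]; linarith)
    have hκ1 : 1 ≤ κ := by linarith
    refine (measure_mono (t := (G κ)ᶜ) ?_).trans
      ((hG κ hκ1).1.trans (ENNReal.ofReal_le_ofReal ?_))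
    · rw [Set.subset_compl_comm]
      intro y hyG hy
      refine hy fun ω hω => ?_
      refine ((hG κ hκ1).2 y hyG ω (hT.trans_le hω)).1.trans ?_
      calc 160 * R * κ * (τ ^ 2 + ω ^ 2) = 160 * (τ ^ 2 + ω ^ 2) * R * κ := by ring
        _ ≤ _ := by
          gcongr
          · norm_num
          · linarith [Real.sqrt_nonneg κ]
    · have e : -2 * (κ - BlindDenoising.intrinsicDim pX σT σ0) = Real.log δ + Real.log δ := by
        rw [hκ, ← hk, one_div, Real.log_inv]; ring
      rw [e, Real.exp_add, Real.exp_log hδ0]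
      nlinarith
  · exact BlindDenoising.mismatchError_le_crossCovError
      (BlindDenoising.ae_norm_le_of_support hR) hT hΘ (hT.trans_le hτ.1)
  · refine (BlindDenoising.crossCovError_le hd hR0.le hR hT h0 hΘ hτ rfl).trans ?_
    have hL : 1 ≤ 1 + Real.log (σ0 / σT) +
        |Real.log (BlindDenoising.noiseMoment pX Θ τ).toReal| := by
      linarith [abs_nonneg (Real.log (BlindDenoising.noiseMoment pX Θ τ).toReal)]
    gcongr ENNReal.ofReal ?_ * _
    rw [← hk]
    refine hlevel _ _ hL (by linarith) ?_
    linarith [hkL _ hL]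
  · refine (BlindDenoising.crossCovError_powerPrior_le hd hR0.le hR hT h0 hτ α rfl).trans ?_
    have hd1 : (1 : ℝ) ≤ d := by exact_mod_cast hd
    have hL : 1 ≤ 1 + Real.log d + Real.log (σ0 / σT) + Real.log (1 + |α|) := by
      linarith [Real.log_nonneg hd1,
        Real.log_nonneg (by linarith [abs_nonneg α] : (1 : ℝ) ≤ 1 + |α|)]
    gcongr ENNReal.ofReal ?_ * _
    rw [← hk]
    refine hlevel _ _ hL (by linarith) ?_
    have h12 : k + 11 * k * (1 + Real.log d + Real.log (σ0 / σT) + Real.log (1 + |α|)) ≤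
        12 * (k * (1 + Real.log d + Real.log (σ0 / σT) + Real.log (1 + |α|))) := by nlinarith
    nlinarith [hkL _ hL]
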